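/- Consider the class of equations $$u_t+u^nu_x+\beta(t)u_{xxx}+\sigma(t)u_{xxxxx}=0, \qquad(*)$$ where $n$ is a nonzero integer and $\beta,\sigma$ are smooth nonvanishing real functions of $t$ on an open interval. Points with $u=0$ are excluded when $n<0$. A \emph{generalized equivalence transformation} for the equations with exponent $n$, on an open set $\Omega$ of points $(t,x,u,\beta,\sigma)$ (with $\beta\ne0$, $\sigma\neq0$), is a smooth transformation $(t,x,u,\beta,\sigma)\mapsto(\tilde t,\tilde x,\tilde u,\tilde\beta,\tilde\sigma)$ with everywhere invertible derivative, together with an integer-valued $\tilde n$ on $\Omega$, such that for every equation $(*)$ with exponent $n$ the induced transformation of $(t,x,u)$ (obtained by inserting $\beta=\beta(t)$, $\sigma=\sigma(t)$) is a nondegenerate point transformation mapping this equation (as a manifold in the fifth-order jet space) to an equation of the class whose arbitrary elements are $\tilde n,\tilde\beta,\tilde\sigma$. It is a \emph{usual} equivalence transformation on an open set $D$ of points $(t,x,u)$ if it is given for all $(t,x,u)\in D$ and all nonzero values of $\beta,\sigma$, and $\tilde t,\tilde x,\tilde u$ depend on $(t,x,u)$ only. For constants $\delta_0,\delta_1,\delta_2,\delta_3\in\mathbb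 R$ with $\delta_1\delta_3\neq0$ consider $$\tilde t=\delta_1\delta_3^{-n}t+\delta_0,\quad \tilde x=\delta_1x+\delta_2,\quad \tilde u=\delta_3u,\quad \tilde\beta(\tilde t)=\delta_1^2\delta_3^n\beta(t),\quad \tilde\sigma(\tilde t)=\delta_1^4\delta_3^n\sigma(t),\quad \tilde n=n.\qquad(**)$$ (i) For every nonzero integer $n$, each transformation $(**)$ is a generalized equivalence transformation, on every open $\Omega$. (ii) For every integer $n\ne0,1$, the generalized equivalence transformations on any connected open $\Omega$, and likewise the usual equivalence transformations on any connected open $D$, are exactly the transformations $(**)$ with arbitrary constants $\delta_0,\delta_1,\delta_2,\delta_3$, $\delta_1\delta_3\ne0$. -/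

import Mathlib

open Filter Topology
open scoped ContDiff

namespace Kawahara

/-- A point `(t, x, u)` of the space of independent and dependent variables. -/
abbrev VarPt := ℝ × ℝ × ℝ

/-- A point `(t, x, u, β, σ)`: the variables together with the values of the functional
arbitrary elements of the class. -/
abbrev ExtPt := ℝ × ℝ × ℝ × ℝ × ℝ

/-- `InClass n J β σ`: the equation `u_t + u ^ n u_x + β(t) u_xxx + σ(t) u_xxxxx = 0`, considered
for `t` in the open interval `J`, belongs to the class: `n` is a nonzero integer, and `β` and `σ`
are smooth nonvanishing functions on `J`. -/
structure InClass (n : ℤ) (J : Set ℝ) (β σ : ℝ → ℝ) : Prop where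
  exponent_ne_zero : n ≠ 0
  isOpen : IsOpen J
  ordConnected : J.OrdConnected
  smooth_beta : ContDiffOn ℝ ∞ β J
  smooth_sigma : ContDiffOn ℝ ∞ σ J
  beta_ne_zero : ∀ t ∈ J, β t ≠ 0
  sigma_ne_zero : ∀ t ∈ J, σ t ≠ 0

/-- The left-hand side `f_t + f ^ n f_x + β(t) f_xxx + σ(t) f_xxxxx`, evaluated at `(t, x)`. -/
noncomputable def lhs (n : ℤ) (β σ : ℝ → ℝ) (f : ℝ × ℝ → ℝ) (t x : ℝ) : ℝ :=
  deriv (fun τ => f (τ, x)) t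
    + f (t, x) ^ n * deriv (fun ξ => f (t, ξ)) x
    + β t * iteratedDeriv 3 (fun ξ => f (t, ξ)) x
    + σ t * iteratedDeriv 5 (fun ξ => f (t, ξ)) x

/-- The components of a transformation of the variables and of the arbitrary elements, for
equations with a given exponent `n`: the new `t`, `x`, `u`, `β`, `σ` and the new exponent, as
functions of `(t, x, u, β, σ)`. -/
structure Transf where
  T : ExtPt → ℝ
  X : ExtPt → ℝ
  U : ExtPt → ℝ
  B : ExtPt → ℝ
  S : ExtPt → ℝ
  N : ExtPt → ℤ

/-- The transformation of `(t, x, u, β, σ)`. -/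
def Transf.toMap (Φ : Transf) (p : ExtPt) : ExtPt := (Φ.T p, Φ.X p, Φ.U p, Φ.B p, Φ.S p)

/-- The point `(t, x, u, β(t), σ(t))`. -/
def lift (β σ : ℝ → ℝ) (q : VarPt) : ExtPt := (q.1, q.2.1, q.2.2, β q.1, σ q.1)

/-- The point transformation of the variables `(t, x, u)` which `Φ` induces for given functions
`β` and `σ`. -/
def Transf.induced (Φ : Transf) (β σ : ℝ → ℝ) (q : VarPt) : VarPt :=
  (Φ.T (lift β σ q), Φ.X (lift β σ q), Φ.U (lift β σ q))

/-- The point transformation `F` of `(t, x, u)` maps, over the point `q`, the equation with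
arbitrary elements `n, β, σ` to the one with `n', β', σ'`.

This is the condition that the fifth prolongation of `F` identifies the manifolds which the two
equations define in the fifth-order jet space, over `q`. A 5-jet over `q` is represented by a
smooth function `f`, and its image under the prolongation by the function `g` whose graph is the
image under `F` of the graph of `f`; the prolongation is defined at this jet if the image of the
graph of `f` is transversal to the `u`-axis. -/
def MapsEquationAt (F : VarPt → VarPt) (q : VarPt)
    (n : ℤ) (β σ : ℝ → ℝ) (n' : ℤ) (β' σ' : ℝ → ℝ) : Prop :=
  ∀ f g : ℝ × ℝ → ℝ,
    ContDiffAt ℝ ∞ f (q.1, q.2.1) →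
    f (q.1, q.2.1) = q.2.2 →
    (fderiv ℝ (fun z : ℝ × ℝ => ((F (z.1, z.2, f z)).1, (F (z.1, z.2, f z)).2.1))
      (q.1, q.2.1)).IsInvertible →
    ContDiffAt ℝ ∞ g ((F q).1, (F q).2.1) →
    (∀ᶠ z in 𝓝 (q.1, q.2.1),
      g ((F (z.1, z.2, f z)).1, (F (z.1, z.2, f z)).2.1) = (F (z.1, z.2, f z)).2.2) →
    (lhs n β σ f q.1 q.2.1 = 0 ↔ lhs n' β' σ' g (F q).1 (F q).2.1 = 0)

/-- The points at which an equation with exponent `n` makes sense: `β` and `σ` do not vanish, and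
neither does `u` if the exponent is negative. -/
def validPts (n : ℤ) : Set ExtPt :=
  {p | p.2.2.2.1 ≠ 0 ∧ p.2.2.2.2 ≠ 0 ∧ (n < 0 → p.2.2.1 ≠ 0)}

/-- `Φ`, on the open set `Ω` of points `(t, x, u, β, σ)`, is a generalized equivalence
transformation for the equations with exponent `n`: it is a nondegenerate point transformation of
the variables and the arbitrary elements, the transformations of `t`, `x`, `u` may involve the
arbitrary elements, and each equation with exponent `n` is mapped to an equation of the class
(whose exponent `n'` is arbitrary) by the induced point transformation of `(t, x, u)`, which is
nondegenerate, the new arbitrary elements being given by the components `N`, `B`, `S`. -/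
def IsGeneralizedEquiv (n : ℤ) (Ω : Set ExtPt) (Φ : Transf) : Prop :=
  ContDiffOn ℝ ∞ Φ.toMap Ω ∧
  (∀ p ∈ Ω, (fderiv ℝ Φ.toMap p).IsInvertible) ∧
  ∀ (J : Set ℝ) (β σ : ℝ → ℝ), InClass n J β σ →
    ∃ (n' : ℤ) (J' : Set ℝ) (β' σ' : ℝ → ℝ), InClass n' J' β' σ' ∧
      ∀ q : VarPt, q.1 ∈ J → lift β σ q ∈ Ω →
        (fderiv ℝ (Φ.induced β σ) q).IsInvertible ∧
        Φ.T (lift β σ q) ∈ J' ∧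
        (n' < 0 → Φ.U (lift β σ q) ≠ 0) ∧
        Φ.N (lift β σ q) = n' ∧
        Φ.B (lift β σ q) = β' (Φ.T (lift β σ q)) ∧
        Φ.S (lift β σ q) = σ' (Φ.T (lift β σ q)) ∧
        MapsEquationAt (Φ.induced β σ) q n β σ n' β' σ'

/-- The points `(t, x, u, β, σ)` with `(t, x, u) ∈ D` and any nonzero `β` and `σ`. -/
def overDomain (D : Set VarPt) : Set ExtPt :=
  {p | (p.1, p.2.1, p.2.2.1) ∈ D ∧ p.2.2.2.1 ≠ 0 ∧ p.2.2.2.2 ≠ 0}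

/-- `Φ` is a usual equivalence transformation, on the domain `D` of points `(t, x, u)` and for all
nonzero values of the arbitrary elements `β` and `σ`: the transformations of `t`, `x` and `u` do
not involve `β` and `σ`. -/
def IsUsualEquiv (n : ℤ) (D : Set VarPt) (Φ : Transf) : Prop :=
  IsGeneralizedEquiv n (overDomain D) Φ ∧
  ∃ F : VarPt → VarPt, ∀ p ∈ overDomain D,
    (Φ.T p, Φ.X p, Φ.U p) = F (p.1, p.2.1, p.2.2.1)

/-- On `Ω`, the transformation `Φ` is given by `t̃ = δ₁ δ₃⁻ⁿ t + δ₀`, `x̃ = δ₁ x + δ₂`, `ũ = δ₃ u`,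
`β̃ = δ₁² δ₃ⁿ β`, `σ̃ = δ₁⁴ δ₃ⁿ σ`, `ñ = n`. -/
def HasForm (n : ℤ) (δ₀ δ₁ δ₂ δ₃ : ℝ) (Ω : Set ExtPt) (Φ : Transf) : Prop :=
  ∀ t x u b s : ℝ, (t, x, u, b, s) ∈ Ω →
    Φ.T (t, x, u, b, s) = δ₁ * δ₃ ^ (-n) * t + δ₀ ∧
    Φ.X (t, x, u, b, s) = δ₁ * x + δ₂ ∧
    Φ.U (t, x, u, b, s) = δ₃ * u ∧
    Φ.B (t, x, u, b, s) = δ₁ ^ 2 * δ₃ ^ n * b ∧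
    Φ.S (t, x, u, b, s) = δ₁ ^ 4 * δ₃ ^ n * s ∧
    Φ.N (t, x, u, b, s) = n

end Kawahara

/-! The necessity part compares two 5-jets of solutions `f₁`, `f₂` at the same point. Their images
`g₁`, `g₂` solve the new equation at the image point, and since they agree there, `Δ = g₂ - g₁`
satisfies `Δ_t + ũ ^ n' Δ_x + β' Δ_xxx + σ' Δ_xxxxx = 0` at that point. Along the graph, `Δ` is
asymptotic to `κ (f₂ - f₁)` with `κ ≠ 0` (`exists_image_difference`). Each choice of `f₂ - f₁`
yields one determining equation:

a difference `(t - t₀) ^ 5` forces `T_x = T_u = 0` (`time_component_fderiv`); `(x - x₀) ^ 5` gives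
`σ' T_t = σ (X_x + X_u γ) ^ 5` for every admissible slope `γ`, hence `X_u = 0`, and `X_x` depends on
`t` only (`sigma_transform`); `(x - x₀) ^ 4`, which the equation does not see, shows that `U_u`
depends on `t` only (`fderiv_unknown_fderiv_apply`); `(x - x₀) ^ 3` gives `β' T_t = β X_x ^ 3`, and
a change of slope gives `T_t U ^ n' = X_x u ^ n + X_t` (`beta_eq`, `power_eq`).

The last relation has the form `τ (A v + B) ^ m = a v ^ n + c` on an interval. For `n ≠ 0, 1` it
leaves only `m = n`, `B = c = 0` (`zpow_affine_rigidity`). Thus `U = A(t) u` and `X_t = 0`, and the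
constant solutions give `U_t = 0`.

All this concerns one equation with fixed `β(t)`, `σ(t)`. Exponentials through a given point `(t, b,
s)` realize all values of `β'(t)`, `σ'(t)`. Comparing them shows that `T`, `X`, `U` do not depend on
`β`, `σ` (`gradient_form`), and connectedness of `Ω` makes the remaining factors constant. For usual
equivalences the domain splits according to the signs of `β` and `σ`, and the constants agree
because `T`, `X`, `U` do not involve `β`, `σ`. The converse is a scaling computation
(`lhs_comp_affine`). -/

namespace Kawahara

/-! ### Taylor coefficients, local inverses, and rigidity of integer powers under affine
substitution. -/

section Analysis

open Asymptotics

theorem isLittleO_sub_leading_term {f : ℝ → ℝ} {y : ℝ} (hf : ContDiffAt ℝ ∞ f y) (j : ℕ)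
    (h : ∀ i < j, iteratedDeriv i f y = 0) :
    (fun z => f z - iteratedDeriv j f y / j.factorial * (z - y) ^ j) =o[𝓝 y]
      fun z => (z - y) ^ j := by
  obtain ⟨u, hu, hfu⟩ := (hf.of_le (m := j) (by exact_mod_cast le_top)).contDiffOn le_rfl (by simp)
  obtain ⟨r, hr, hru⟩ := Metric.mem_nhds_iff.1 hu
  have hfb : ContDiffOn ℝ j f (Metric.ball y r) := hfu.mono hru
  have ht := taylor_isLittleO (convex_ball y r) (Metric.mem_ball_self hr) hfb
  rw [nhdsWithin_eq_nhds.2 (Metric.ball_mem_nhds y hr)] at ht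
  refine ht.congr_left fun z => ?_
  rw [taylor_within_apply, Finset.sum_range_succ, Finset.sum_eq_zero, zero_add,
    iteratedDerivWithin_of_isOpen Metric.isOpen_ball (Metric.mem_ball_self hr), smul_eq_mul]
  · ring
  · intro i hi
    rw [iteratedDerivWithin_of_isOpen Metric.isOpen_ball (Metric.mem_ball_self hr),
      h i (Finset.mem_range.1 hi), smul_zero]

/-- Strong induction on the order: once the lower derivatives vanish, `f ∘ χ` is its leading term up
to `o((z - x) ^ j)`. As `χ z - χ x` is exactly of order `z - x`, a nonzero leading coefficient would
contradict the assumed decay. -/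
theorem iteratedDeriv_eq_zero_of_isLittleO_comp {f χ : ℝ → ℝ} {x d : ℝ} {k : ℕ}
    (hχ : HasDerivAt χ d x) (hd : d ≠ 0) (hf : ContDiffAt ℝ ∞ f (χ x))
    (h : (fun z => f (χ z)) =o[𝓝 x] fun z => (z - x) ^ k) :
    ∀ j ≤ k, iteratedDeriv j f (χ x) = 0 := by
  intro j
  induction j using Nat.strong_induction_on with
  | _ j ih =>
    intro hj
    have hlead := isLittleO_sub_leading_term hf j fun i hi => ih i hi (hi.le.trans hj)
    have hO : (fun z => χ z - χ x) =O[𝓝 x] fun z => z - x := hχ.differentiableAt.isBigO_sub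
    have hO' : (fun z => z - x) =O[𝓝 x] fun z => χ z - χ x := by
      have hlin : (fun z => χ z - χ x - (z - x) * d) =o[𝓝 x] fun z => z - x := by
        simpa using hχ.isLittleO
      have hlin2 : (fun z => χ z - χ x - (z - x) * d) =o[𝓝 x] fun z => (z - x) * d :=
        hlin.trans_isBigO ((isBigO_self_const_mul hd (fun z => z - x) _).congr_right
          fun z => mul_comm _ _)
      have := IsEquivalent.isBigO_symm (u := fun z => χ z - χ x) (v := fun z => (z - x) * d) hlin2
      exact ((isBigO_self_const_mul hd (fun z => z - x) _).congr_right
          fun z => mul_comm _ _).trans this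
    have h1 : (fun z => f (χ z) - iteratedDeriv j f (χ x) / j.factorial * (χ z - χ x) ^ j)
        =o[𝓝 x] fun z => (z - x) ^ j :=
      (hlead.comp_tendsto hχ.continuousAt.tendsto).trans_isBigO (hO.pow j)
    have h2 : (fun z => f (χ z)) =o[𝓝 x] fun z => (z - x) ^ j := by
      refine h.trans_isBigO ?_
      obtain ⟨m, rfl⟩ := Nat.exists_eq_add_of_le hj
      have hb : (fun z : ℝ => (z - x) ^ m) =O[𝓝 x] fun _ => (1 : ℝ) :=
        (show ContinuousAt (fun z : ℝ => (z - x) ^ m) x by fun_prop).tendsto.isBigO_one ℝ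
      simpa [pow_add] using (isBigO_refl (fun z : ℝ => (z - x) ^ j) (𝓝 x)).mul hb
    have h3 : (fun z => iteratedDeriv j f (χ x) / j.factorial * (χ z - χ x) ^ j)
        =o[𝓝 x] fun z => (z - x) ^ j := (h2.sub h1).congr_left fun z => by ring
    by_contra hne
    have hc : iteratedDeriv j f (χ x) / (j.factorial : ℝ) ≠ 0 :=
      div_ne_zero hne (by exact_mod_cast j.factorial_ne_zero)
    have h4 : (fun z => (z - x) ^ j) =o[𝓝 x] fun z => (z - x) ^ j :=
      ((hO'.pow j).trans (isBigO_self_const_mul hc _ _)).trans_isLittleO h3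
    refine isLittleO_irrefl ?_ h4
    have h5 : ∀ᶠ z in 𝓝[≠] x, (z - x) ^ j ≠ 0 := by
      filter_upwards [self_mem_nhdsWithin] with z hz
      exact pow_ne_zero _ (sub_ne_zero.2 hz)
    exact h5.frequently.filter_mono nhdsWithin_le_nhds

/-- Taylor coefficients are determined by the asymptotics along a regular parametrization. -/
theorem iteratedDeriv_eq_of_isLittleO_comp {f g χ : ℝ → ℝ} {x y d : ℝ} {k : ℕ}
    (hχ : HasDerivAt χ d x) (hd : d ≠ 0) (hy : χ x = y) (hf : ContDiffAt ℝ ∞ f y)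
    (hg : ContDiffAt ℝ ∞ g y)
    (h : (fun z => f (χ z) - g (χ z)) =o[𝓝 x] fun z => (z - x) ^ k) {j : ℕ} (hj : j ≤ k) :
    iteratedDeriv j f y = iteratedDeriv j g y := by
  subst hy
  have := iteratedDeriv_eq_zero_of_isLittleO_comp (f := f - g) hχ hd (hf.sub hg) h j hj
  rw [iteratedDeriv_sub (hf.of_le (by exact_mod_cast le_top))
    (hg.of_le (by exact_mod_cast le_top))] at this
  linarith

theorem deriv_quintic (c₀ c₁ c₂ c₃ c₄ c₅ y : ℝ) :
    deriv (fun z => c₀ + c₁ * (z - y) + c₂ * (z - y) ^ 2 + c₃ * (z - y) ^ 3 + c₄ * (z - y) ^ 4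
      + c₅ * (z - y) ^ 5) = fun z => c₁ + 2 * c₂ * (z - y) + 3 * c₃ * (z - y) ^ 2
      + 4 * c₄ * (z - y) ^ 3 + 5 * c₅ * (z - y) ^ 4 + 0 * (z - y) ^ 5 := by
  ext z
  have h : HasDerivAt (fun z => z - y) 1 z := (hasDerivAt_id z).sub_const y
  have := (((((h.const_mul c₁).const_add c₀).add ((h.pow 2).const_mul c₂)).add
    ((h.pow 3).const_mul c₃)).add ((h.pow 4).const_mul c₄)).add ((h.pow 5).const_mul c₅)
  refine HasDerivAt.deriv (this.congr_deriv ?_)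
  norm_num
  ring

theorem iteratedDeriv_quintic (c₀ c₁ c₃ c₄ c₅ y : ℝ) :
    let f := fun z => c₀ + c₁ * (z - y) + c₃ * (z - y) ^ 3 + c₄ * (z - y) ^ 4 + c₅ * (z - y) ^ 5
    iteratedDeriv 1 f y = c₁ ∧ iteratedDeriv 3 f y = 6 * c₃ ∧ iteratedDeriv 5 f y = 120 * c₅ := by
  intro f
  have hf : f = fun z => c₀ + c₁ * (z - y) + 0 * (z - y) ^ 2 + c₃ * (z - y) ^ 3
      + c₄ * (z - y) ^ 4 + c₅ * (z - y) ^ 5 := by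
    ext z; simp only [f]; ring
  rw [hf]
  refine ⟨?_, ?_, ?_⟩
  · simp only [iteratedDeriv_succ', iteratedDeriv_zero, deriv_quintic]
    ring
  · simp only [iteratedDeriv_succ', iteratedDeriv_zero, deriv_quintic]
    ring
  · simp only [iteratedDeriv_succ', iteratedDeriv_zero, deriv_quintic]
    ring

theorem exists_local_inverse {E : Type*} [NormedAddCommGroup E] [NormedSpace ℝ E]
    [CompleteSpace E] {P : E → E} {z : E} (hP : ContDiffAt ℝ ∞ P z)
    (hinv : (fderiv ℝ P z).IsInvertible) :
    ∃ ψ : E → E, ContDiffAt ℝ ∞ ψ (P z) ∧ ψ (P z) = z ∧ (∀ᶠ y in 𝓝 (P z), P (ψ y) = y) ∧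
      ∀ᶠ w in 𝓝 z, ψ (P w) = w := by
  obtain ⟨e, he⟩ := hinv
  have hd : HasFDerivAt P (e : E →L[ℝ] E) z := by
    rw [he]; exact (hP.differentiableAt (by simp)).hasFDerivAt
  have hs := hP.hasStrictFDerivAt' hd (by simp)
  exact ⟨hP.localInverse hd (by simp), hP.to_localInverse hd (by simp),
    hP.localInverse_apply_image hd (by simp), hs.eventually_right_inverse,
    hs.eventually_left_inverse⟩

theorem eq_of_fderiv_eq_zero_along {E : Type*} [NormedAddCommGroup E] [NormedSpace ℝ E]
    {G : E → ℝ} {s : Set E} (hs : Convex ℝ s) (hG : ∀ z ∈ s, DifferentiableAt ℝ G z) {x y : E}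
    (hx : x ∈ s) (hy : y ∈ s) (h : ∀ z ∈ s, fderiv ℝ G z (y - x) = 0) : G y = G x := by
  obtain ⟨z, hz, hzz⟩ := domain_mvt (fun w hw => (hG w hw).hasFDerivAt.hasFDerivWithinAt) hs hx hy
  rw [h z (hs.segment_subset hx hy hz)] at hzz
  linarith

theorem eventually_nhdsNE_ne (u w : ℝ) : ∀ᶠ v in 𝓝[≠] u, v ≠ w := by
  by_cases h : u = w
  · subst h; exact self_mem_nhdsWithin
  · exact (eventually_ne_nhds h).filter_mono nhdsWithin_le_nhds

/-- Differentiating and eliminating the power of `A v + B` leaves a combination of `v ^ n`, `v ^ (n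
- 1)` and `1`. Another derivative, divided by a power of `v`, leaves an affine function of `v` that
vanishes identically. For `n = 1` the constants `B` and `c` would survive, which is where Galilean
boosts come from. -/
theorem zpow_affine_rigidity_of_ne_zero {m n : ℤ} {A B a c τ u : ℝ} (hn : n ≠ 0) (hn1 : n ≠ 1)
    (hm : m ≠ 0) (hA : A ≠ 0) (ha : a ≠ 0) (hu : u ≠ 0) (hAu : A * u + B ≠ 0)
    (h : ∀ᶠ v in 𝓝 u, τ * (A * v + B) ^ m = a * v ^ n + c) :
    m = n ∧ B = 0 ∧ c = 0 ∧ τ * A ^ n = a := by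
  have hlin : ∀ v : ℝ, HasDerivAt (fun v => A * v + B) A v := fun v => by
    simpa using ((hasDerivAt_id v).const_mul A).add_const B
  have hcont : ∀ᶠ v in 𝓝 u, A * v + B ≠ 0 :=
    ContinuousAt.eventually_ne (g := fun v => A * v + B) (by fun_prop) hAu
  have h1 : ∀ᶠ v in 𝓝 u, (m - n) * a * A * v ^ n - a * n * B * v ^ (n - 1) + m * A * c = 0 := by
    filter_upwards [h.eventually_nhds, hcont, eventually_ne_nhds hu] with v hv hv1 hv0
    have hd1 := (((hasDerivAt_zpow m (A * v + B) (.inl hv1)).comp v (hlin v)).const_mul τ)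
    have hd2 := (((hasDerivAt_zpow n v (.inl hv0)).const_mul a).add_const c)
    have he := (hd1.congr_of_eventuallyEq (f₁ := fun v => a * v ^ n + c)
      (hv.mono fun w hw => hw.symm)).unique hd2
    have hv' := hv.self_of_nhds
    have e1 : (A * v + B) ^ m = (A * v + B) ^ (m - 1) * (A * v + B) := by
      rw [zpow_sub_one₀ hv1]; field_simp
    have e2 : v ^ n = v ^ (n - 1) * v := by
      rw [zpow_sub_one₀ hv0]; field_simp
    rw [e1] at hv'
    rw [e2] at hv' ⊢
    apply mul_left_cancel₀ hv0
    linear_combination (-v * (m : ℝ) * A) * hv' + v * (A * v + B) * he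
  have h2 : ∀ᶠ v in 𝓝 u, (m - n) * A * v - (n - 1) * B = 0 := by
    filter_upwards [h1.eventually_nhds, eventually_ne_nhds hu] with v hv hv0
    have hd1 := (((hasDerivAt_zpow n v (.inl hv0)).const_mul ((m - n) * a * A)).sub
      ((hasDerivAt_zpow (n - 1) v (.inl hv0)).const_mul (a * n * B))).add_const (m * A * c)
    have he := (hd1.congr_of_eventuallyEq (f₁ := fun _ => (0 : ℝ))
      (hv.mono fun w hw => hw.symm)).unique (hasDerivAt_const v 0)
    have e2 : v ^ (n - 1) = v ^ (n - 1 - 1) * v := by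
      rw [zpow_sub_one₀ hv0 (n - 1)]; field_simp
    rw [e2] at he
    have hz : a * n * v ^ (n - 1 - 1) ≠ 0 :=
      mul_ne_zero (mul_ne_zero ha (by exact_mod_cast hn)) (zpow_ne_zero _ hv0)
    apply mul_left_cancel₀ hz
    push_cast at he
    linear_combination he
  have h3 : ((m : ℝ) - n) * A = 0 := by
    have hd1 := (((hasDerivAt_id u).const_mul (((m : ℝ) - n) * A)).sub_const ((n - 1) * B))
    have he := (hd1.congr_of_eventuallyEq (f₁ := fun _ => (0 : ℝ))
      (h2.mono fun w hw => hw.symm)).unique (hasDerivAt_const u 0)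
    simpa using he
  have hmn : (m : ℝ) - n = 0 := (mul_eq_zero.1 h3).resolve_right hA
  have hmn' : m = n := by exact_mod_cast sub_eq_zero.1 hmn
  have hB : B = 0 := by
    have := h2.self_of_nhds
    rw [hmn] at this
    have hne : (n : ℝ) - 1 ≠ 0 := sub_ne_zero.2 (by exact_mod_cast hn1)
    have h0 : ((n : ℝ) - 1) * B = 0 := by linarith
    exact (mul_eq_zero.1 h0).resolve_left hne
  have hc : c = 0 := by
    have := h1.self_of_nhds
    rw [hmn, hB] at this
    have h0 : (m : ℝ) * A * c = 0 := by linarith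
    exact (mul_eq_zero.1 h0).resolve_left (mul_ne_zero (by exact_mod_cast hm) hA)
  refine ⟨hmn', hB, hc, ?_⟩
  have := h.self_of_nhds
  rw [hmn', hB, hc, add_zero, add_zero, mul_zpow] at this
  exact mul_right_cancel₀ (zpow_ne_zero n hu) (by linear_combination this)

theorem zpow_affine_rigidity {m n : ℤ} {A B a c τ u : ℝ} (hn : n ≠ 0) (hn1 : n ≠ 1)
    (hm : m ≠ 0) (hA : A ≠ 0) (ha : a ≠ 0)
    (h : ∀ᶠ v in 𝓝 u, τ * (A * v + B) ^ m = a * v ^ n + c) :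
    m = n ∧ B = 0 ∧ c = 0 ∧ τ * A ^ n = a := by
  -- Both bases may vanish at `u` itself, so the base point is moved to a nearby `v` where neither
  -- does.
  obtain ⟨v, hv, hv0, hv1⟩ := ((h.eventually_nhds.filter_mono nhdsWithin_le_nhds).and
    ((eventually_nhdsNE_ne u 0).and (eventually_nhdsNE_ne u (-B / A)))).exists
  refine zpow_affine_rigidity_of_ne_zero hn hn1 hm hA ha hv0 (fun h0 => hv1 ?_) hv
  field_simp
  linarith

end Analysis
-- Test jets, images of graphs, and the comparison of two solution jets.
section Jets

open Asymptotics

theorem isInvertible_of_injective {E : Type*} [NormedAddCommGroup E] [NormedSpace ℝ E]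
    [FiniteDimensional ℝ E] (L : E →L[ℝ] E) (h : ∀ v, L v = 0 → v = 0) : L.IsInvertible := by
  have hi : Function.Injective (L : E →ₗ[ℝ] E) := (injective_iff_map_eq_zero _).2 h
  exact ⟨(LinearEquiv.ofInjectiveEndo _ hi).toContinuousLinearEquiv,
    ContinuousLinearMap.ext fun _ => rfl⟩

theorem contDiffAt_slice {g : ℝ × ℝ → ℝ} {s y : ℝ} (hg : ContDiffAt ℝ ∞ g (s, y)) :
    ContDiffAt ℝ ∞ (fun ξ => g (s, ξ)) y :=
  ContDiffAt.comp (f := fun ξ : ℝ => (s, ξ)) y hg (by fun_prop)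

theorem deriv_fst_slice {g : ℝ × ℝ → ℝ} {s y : ℝ} (hg : DifferentiableAt ℝ g (s, y)) :
    deriv (fun τ => g (τ, y)) s = fderiv ℝ g (s, y) (1, 0) := by
  have h : HasDerivAt (fun τ : ℝ => (τ, y)) ((1 : ℝ), (0 : ℝ)) s :=
    (hasDerivAt_id s).prodMk (hasDerivAt_const s y)
  exact (hg.hasFDerivAt.comp_hasDerivAt (f := fun τ : ℝ => (τ, y)) s h).deriv

theorem deriv_snd_slice {g : ℝ × ℝ → ℝ} {s y : ℝ} (hg : DifferentiableAt ℝ g (s, y)) :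
    deriv (fun ξ => g (s, ξ)) y = fderiv ℝ g (s, y) (0, 1) := by
  have h : HasDerivAt (fun ξ : ℝ => (s, ξ)) ((0 : ℝ), (1 : ℝ)) y :=
    (hasDerivAt_const y s).prodMk (hasDerivAt_id y)
  exact (hg.hasFDerivAt.comp_hasDerivAt (f := fun ξ : ℝ => (s, ξ)) y h).deriv

/-- The polynomial with value `u` at `(t, x)` for `q = (t, x, u)` and the given coefficients. -/
def testFn (q : VarPt) (α γ c₃ c₄ c₅ d : ℝ) (z : ℝ × ℝ) : ℝ :=
  q.2.2 + α * (z.1 - q.1) + γ * (z.2 - q.2.1) + c₃ * (z.2 - q.2.1) ^ 3 + c₄ * (z.2 - q.2.1) ^ 4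
    + c₅ * (z.2 - q.2.1) ^ 5 + d * (z.1 - q.1) ^ 5

theorem testFn_self (q : VarPt) (α γ c₃ c₄ c₅ d : ℝ) :
    testFn q α γ c₃ c₄ c₅ d (q.1, q.2.1) = q.2.2 := by
  simp [testFn]

theorem contDiff_testFn (q : VarPt) (α γ c₃ c₄ c₅ d : ℝ) :
    ContDiff ℝ ∞ (testFn q α γ c₃ c₄ c₅ d) := by
  unfold testFn
  fun_prop

theorem fderiv_testFn (q : VarPt) (α γ c₃ c₄ c₅ d : ℝ) (v : ℝ × ℝ) :
    fderiv ℝ (testFn q α γ c₃ c₄ c₅ d) (q.1, q.2.1) v = α * v.1 + γ * v.2 := by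
  have h1 : HasFDerivAt (fun z : ℝ × ℝ => z.1 - q.1) (ContinuousLinearMap.fst ℝ ℝ ℝ) (q.1, q.2.1) :=
    hasFDerivAt_fst.sub_const _
  have h2 : HasFDerivAt (fun z : ℝ × ℝ => z.2 - q.2.1) (ContinuousLinearMap.snd ℝ ℝ ℝ)
      (q.1, q.2.1) := hasFDerivAt_snd.sub_const _
  have h := ((((((h1.const_mul α).const_add q.2.2).add (h2.const_mul γ)).add
    ((h2.pow 3).const_mul c₃)).add ((h2.pow 4).const_mul c₄)).add ((h2.pow 5).const_mul c₅)).add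
    ((h1.pow 5).const_mul d)
  have := h.fderiv
  change fderiv ℝ (testFn q α γ c₃ c₄ c₅ d) (q.1, q.2.1) = _ at this
  rw [this]
  simp

theorem lhs_testFn (n : ℤ) (β σ : ℝ → ℝ) (q : VarPt) (α γ c₃ c₄ c₅ d : ℝ) :
    lhs n β σ (testFn q α γ c₃ c₄ c₅ d) q.1 q.2.1
      = α + q.2.2 ^ n * γ + β q.1 * (6 * c₃) + σ q.1 * (120 * c₅) := by
  have hs : (fun ξ => testFn q α γ c₃ c₄ c₅ d (q.1, ξ)) = fun ξ => q.2.2 + γ * (ξ - q.2.1)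
      + c₃ * (ξ - q.2.1) ^ 3 + c₄ * (ξ - q.2.1) ^ 4 + c₅ * (ξ - q.2.1) ^ 5 := by
    ext ξ; simp [testFn]
  obtain ⟨h1, h3, h5⟩ := iteratedDeriv_quintic q.2.2 γ c₃ c₄ c₅ q.2.1
  rw [iteratedDeriv_one] at h1
  rw [lhs, deriv_fst_slice ((contDiff_testFn q α γ c₃ c₄ c₅ d).differentiable (by simp) _),
    fderiv_testFn, testFn_self, hs, h1, h3, h5]
  ring

/-- The new independent variables along the graph of `f`, under the transformation `F`. -/
def baseImage (F : VarPt → VarPt) (f : ℝ × ℝ → ℝ) (z : ℝ × ℝ) : ℝ × ℝ :=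
  ((F (z.1, z.2, f z)).1, (F (z.1, z.2, f z)).2.1)

section Prolongation

variable {F : VarPt → VarPt} {q : VarPt} {f f₁ f₂ : ℝ × ℝ → ℝ}

theorem hasFDerivAt_graph (hf : ContDiffAt ℝ ∞ f (q.1, q.2.1)) :
    HasFDerivAt (fun z : ℝ × ℝ => ((z.1, z.2, f z) : VarPt))
      ((ContinuousLinearMap.fst ℝ ℝ ℝ).prod ((ContinuousLinearMap.snd ℝ ℝ ℝ).prod
        (fderiv ℝ f (q.1, q.2.1)))) (q.1, q.2.1) :=
  hasFDerivAt_fst.prodMk (hasFDerivAt_snd.prodMk (hf.differentiableAt (by simp)).hasFDerivAt)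

theorem hasFDerivAt_comp_graph {G : Type*} [NormedAddCommGroup G] [NormedSpace ℝ G]
    {H : VarPt → G} (hH : DifferentiableAt ℝ H q)
    (hf : ContDiffAt ℝ ∞ f (q.1, q.2.1)) (hq : f (q.1, q.2.1) = q.2.2) :
    HasFDerivAt (fun z : ℝ × ℝ => H (z.1, z.2, f z))
      ((fderiv ℝ H q).comp ((ContinuousLinearMap.fst ℝ ℝ ℝ).prod
        ((ContinuousLinearMap.snd ℝ ℝ ℝ).prod (fderiv ℝ f (q.1, q.2.1))))) (q.1, q.2.1) := by
  refine HasFDerivAt.comp (g := H) (f := fun z : ℝ × ℝ => ((z.1, z.2, f z) : VarPt)) _ ?_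
    (hasFDerivAt_graph hf)
  simp only [hq]
  exact hH.hasFDerivAt

theorem contDiffAt_comp_graph {G : Type*} [NormedAddCommGroup G] [NormedSpace ℝ G]
    {H : VarPt → G} (hH : ContDiffAt ℝ ∞ H q)
    (hf : ContDiffAt ℝ ∞ f (q.1, q.2.1)) (hq : f (q.1, q.2.1) = q.2.2) :
    ContDiffAt ℝ ∞ (fun z : ℝ × ℝ => H (z.1, z.2, f z)) (q.1, q.2.1) := by
  refine ContDiffAt.comp (g := H) (f := fun z : ℝ × ℝ => ((z.1, z.2, f z) : VarPt)) _ ?_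
    (contDiffAt_fst.prodMk (contDiffAt_snd.prodMk hf))
  simp only [hq]
  exact hH

theorem contDiffAt_baseImage (hF : ContDiffAt ℝ ∞ F q) (hf : ContDiffAt ℝ ∞ f (q.1, q.2.1))
    (hq : f (q.1, q.2.1) = q.2.2) : ContDiffAt ℝ ∞ (baseImage F f) (q.1, q.2.1) := by
  have h := contDiffAt_comp_graph hF hf hq
  exact h.fst.prodMk h.snd.fst

theorem baseImage_self (hq : f (q.1, q.2.1) = q.2.2) :
    baseImage F f (q.1, q.2.1) = ((F q).1, (F q).2.1) := by
  simp [baseImage, hq]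

theorem fderiv_baseImage (hF : ContDiffAt ℝ ∞ F q) (hf : ContDiffAt ℝ ∞ f (q.1, q.2.1))
    (hq : f (q.1, q.2.1) = q.2.2) (v : ℝ × ℝ) :
    fderiv ℝ (baseImage F f) (q.1, q.2.1) v =
      ((fderiv ℝ F q (v.1, v.2, fderiv ℝ f (q.1, q.2.1) v)).1,
        (fderiv ℝ F q (v.1, v.2, fderiv ℝ f (q.1, q.2.1) v)).2.1) := by
  have h := hasFDerivAt_comp_graph (hF.differentiableAt (by simp)) hf hq
  have h' : HasFDerivAt (baseImage F f) _ (q.1, q.2.1) := h.fst.prodMk h.snd.fst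
  rw [h'.fderiv]
  rfl

/-- The image of the graph of `f` is the graph of a smooth function `g`. -/
theorem exists_image (hF : ContDiffAt ℝ ∞ F q) (hf : ContDiffAt ℝ ∞ f (q.1, q.2.1))
    (hq : f (q.1, q.2.1) = q.2.2)
    (hP : (fderiv ℝ (baseImage F f) (q.1, q.2.1)).IsInvertible) :
    ∃ g : ℝ × ℝ → ℝ, ContDiffAt ℝ ∞ g ((F q).1, (F q).2.1) ∧
      ∀ᶠ z in 𝓝 (q.1, q.2.1), g (baseImage F f z) = (F (z.1, z.2, f z)).2.2 := by
  obtain ⟨ψ, hψ, hψ0, -, hl⟩ := exists_local_inverse (contDiffAt_baseImage hF hf hq) hP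
  rw [baseImage_self hq] at hψ hψ0
  have h := (contDiffAt_comp_graph hF hf hq).snd.snd
  refine ⟨fun y => (F ((ψ y).1, (ψ y).2, f (ψ y))).2.2, ?_, ?_⟩
  · refine ContDiffAt.comp (g := fun z : ℝ × ℝ => (F (z.1, z.2, f z)).2.2) (f := ψ) _ ?_ hψ
    rw [hψ0]
    exact h
  · filter_upwards [hl] with z hz
    rw [hz]

theorem image_self {g : ℝ × ℝ → ℝ} (hq : f (q.1, q.2.1) = q.2.2)
    (hg : ∀ᶠ z in 𝓝 (q.1, q.2.1), g (baseImage F f z) = (F (z.1, z.2, f z)).2.2) :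
    g ((F q).1, (F q).2.1) = (F q).2.2 := by
  simpa [baseImage_self hq, hq] using hg.self_of_nhds

/-- The two functions agree at the point, so the nonlinear coefficient is common to both and the
difference is linear in `g₂ - g₁`. -/
theorem lhs_sub_lhs {n : ℤ} {β σ : ℝ → ℝ} {g₁ g₂ : ℝ × ℝ → ℝ} {s y : ℝ}
    (h₁ : ContDiffAt ℝ ∞ g₁ (s, y)) (h₂ : ContDiffAt ℝ ∞ g₂ (s, y)) (h : g₁ (s, y) = g₂ (s, y)) :
    lhs n β σ g₂ s y - lhs n β σ g₁ s y = fderiv ℝ (g₂ - g₁) (s, y) (1, 0)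
      + g₂ (s, y) ^ n * iteratedDeriv 1 (fun ξ => (g₂ - g₁) (s, ξ)) y
      + β s * iteratedDeriv 3 (fun ξ => (g₂ - g₁) (s, ξ)) y
      + σ s * iteratedDeriv 5 (fun ξ => (g₂ - g₁) (s, ξ)) y := by
  have hk : ∀ k : ℕ, iteratedDeriv k (fun ξ => (g₂ - g₁) (s, ξ)) y
      = iteratedDeriv k (fun ξ => g₂ (s, ξ)) y - iteratedDeriv k (fun ξ => g₁ (s, ξ)) y :=
    fun k => iteratedDeriv_sub ((contDiffAt_slice h₂).of_le (by exact_mod_cast le_top))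
      ((contDiffAt_slice h₁).of_le (by exact_mod_cast le_top))
  have d₁ := h₁.differentiableAt (by simp)
  have d₂ := h₂.differentiableAt (by simp)
  rw [hk, hk, hk, fderiv_sub d₂ d₁, lhs, lhs, deriv_fst_slice d₁, deriv_fst_slice d₂, h,
    iteratedDeriv_one, iteratedDeriv_one]
  simp only [sub_apply]
  ring

/-- Comparison of the images of two solution jets under a transformation which maps an equation
of the class to an equation of the class. -/
theorem exists_image_difference {n n' : ℤ} {β σ β' σ' : ℝ → ℝ} (hF : ContDiffAt ℝ ∞ F q)
    (hinv : (fderiv ℝ F q).IsInvertible) (hmap : MapsEquationAt F q n β σ n' β' σ')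
    (hf₁ : ContDiffAt ℝ ∞ f₁ (q.1, q.2.1)) (hf₂ : ContDiffAt ℝ ∞ f₂ (q.1, q.2.1))
    (hq₁ : f₁ (q.1, q.2.1) = q.2.2) (hq₂ : f₂ (q.1, q.2.1) = q.2.2)
    (hP₁ : (fderiv ℝ (baseImage F f₁) (q.1, q.2.1)).IsInvertible)
    (hP₂ : (fderiv ℝ (baseImage F f₂) (q.1, q.2.1)).IsInvertible)
    (hl₁ : lhs n β σ f₁ q.1 q.2.1 = 0) (hl₂ : lhs n β σ f₂ q.1 q.2.1 = 0) :
    ∃ (Δ : ℝ × ℝ → ℝ) (κ : ℝ), ContDiffAt ℝ ∞ Δ ((F q).1, (F q).2.1) ∧ κ ≠ 0 ∧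
      ((fderiv ℝ F q (0, 0, 1)).1 = 0 → (fderiv ℝ F q (0, 0, 1)).2.1 = 0 →
        κ = (fderiv ℝ F q (0, 0, 1)).2.2) ∧
      ((fun z => Δ (baseImage F f₂ z) - κ * (f₂ z - f₁ z)) =o[𝓝 (q.1, q.2.1)]
        fun z => f₂ z - f₁ z) ∧
      (∀ v, fderiv ℝ Δ ((F q).1, (F q).2.1) (fderiv ℝ (baseImage F f₂) (q.1, q.2.1) v)
        = κ * (fderiv ℝ f₂ (q.1, q.2.1) v - fderiv ℝ f₁ (q.1, q.2.1) v)) ∧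
      (∀ᶠ z in 𝓝 (q.1, q.2.1), baseImage F f₁ z = baseImage F f₂ z →
        Δ (baseImage F f₂ z) = (F (z.1, z.2, f₂ z)).2.2 - (F (z.1, z.2, f₁ z)).2.2) ∧
      fderiv ℝ Δ ((F q).1, (F q).2.1) (1, 0)
        + (F q).2.2 ^ n' * iteratedDeriv 1 (fun ξ => Δ ((F q).1, ξ)) (F q).2.1
        + β' (F q).1 * iteratedDeriv 3 (fun ξ => Δ ((F q).1, ξ)) (F q).2.1
        + σ' (F q).1 * iteratedDeriv 5 (fun ξ => Δ ((F q).1, ξ)) (F q).2.1 = 0 := by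
  obtain ⟨g₁, hg₁, he₁⟩ := exists_image hF hf₁ hq₁ hP₁
  obtain ⟨g₂, hg₂, he₂⟩ := exists_image hF hf₂ hq₂ hP₂
  have hl₁' := (hmap f₁ g₁ hf₁ hq₁ hP₁ hg₁ he₁).1 hl₁
  have hl₂' := (hmap f₂ g₂ hf₂ hq₂ hP₂ hg₂ he₂).1 hl₂
  have hv₁ := image_self hq₁ he₁
  have hv₂ := image_self hq₂ he₂
  set y₀ : ℝ × ℝ := ((F q).1, (F q).2.1) with hy₀
  set z₀ : ℝ × ℝ := (q.1, q.2.1) with hz₀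
  -- `H` is a defining function, pulled back by `F`, of the graph of `g₁`: it vanishes on the graph
  -- of `f₁`, and on the graph of `f₂` it equals `g₂ - g₁` at the image point.
  let H : VarPt → ℝ := fun r => (F r).2.2 - g₁ ((F r).1, (F r).2.1)
  have hHs : ContDiffAt ℝ ∞ H q :=
    hF.snd.snd.sub (ContDiffAt.comp (g := g₁) (f := fun r => ((F r).1, (F r).2.1)) q hg₁
      (hF.fst.prodMk hF.snd.fst))
  have hFd : HasFDerivAt F (fderiv ℝ F q) q := (hF.differentiableAt (by simp)).hasFDerivAt
  have hHd : ∀ r, fderiv ℝ H q r = (fderiv ℝ F q r).2.2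
      - fderiv ℝ g₁ y₀ ((fderiv ℝ F q r).1, (fderiv ℝ F q r).2.1) := by
    intro r
    have h1 : HasFDerivAt (fun r => ((F r).1, (F r).2.1)) _ q := hFd.fst.prodMk hFd.snd.fst
    have h2 : HasFDerivAt H _ q := hFd.snd.snd.sub
      (HasFDerivAt.comp (g := g₁) (f := fun r => ((F r).1, (F r).2.1)) q
        (hg₁.differentiableAt (by simp)).hasFDerivAt h1)
    rw [h2.fderiv]
    rfl
  have hH₁ : ∀ᶠ z in 𝓝 z₀, H (z.1, z.2, f₁ z) = 0 := by
    filter_upwards [he₁] with z hz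
    simp only [H]
    rw [← hz]
    exact sub_self _
  have hH₂ : ∀ᶠ z in 𝓝 z₀, (g₂ - g₁) (baseImage F f₂ z) = H (z.1, z.2, f₂ z) := by
    filter_upwards [he₂] with z hz
    simp only [H, Pi.sub_apply]
    rw [hz]
    rfl
  have hvert : ∀ c : ℝ, fderiv ℝ H q (0, 0, c) = fderiv ℝ H q (0, 0, 1) * c := by
    intro c
    have : ((0, 0, c) : VarPt) = c • ((0, 0, 1) : VarPt) := by simp
    rw [this, map_smul, smul_eq_mul, mul_comm]
  -- Otherwise the `u`-direction and a tangent vector of the graph of `f₁` with the same new base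
  -- components would both lie in the kernel of `dH`. Their images under `dF` would then coincide,
  -- although the `u`-direction is not tangent to a graph.
  have hκ : fderiv ℝ H q (0, 0, 1) ≠ 0 := by
    intro h0
    obtain ⟨v, hv⟩ := hP₁.surjective
      ((fderiv ℝ F q (0, 0, 1)).1, (fderiv ℝ F q (0, 0, 1)).2.1)
    have hH0 : fderiv ℝ H q (v.1, v.2, fderiv ℝ f₁ z₀ v) = 0 := by
      have h1 := hasFDerivAt_comp_graph (hHs.differentiableAt (by simp)) hf₁ hq₁
      have h2 := (h1.congr_of_eventuallyEq (f₁ := fun _ => (0 : ℝ))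
        (hH₁.mono fun z hz => hz.symm)).unique (hasFDerivAt_const 0 _)
      simpa using DFunLike.congr_fun h2 v
    rw [fderiv_baseImage hF hf₁ hq₁] at hv
    have hv1 := congrArg Prod.fst hv
    have hv2 := congrArg Prod.snd hv
    simp only at hv1 hv2
    rw [hHd] at h0 hH0
    rw [hv1, hv2] at hH0
    have heq : fderiv ℝ F q (v.1, v.2, fderiv ℝ f₁ z₀ v) = fderiv ℝ F q (0, 0, 1) := by
      refine Prod.ext hv1 (Prod.ext hv2 ?_)
      linarith
    have := hinv.injective heq
    simp only [Prod.mk.injEq] at this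
    obtain ⟨e1, e2, e3⟩ := this
    have hv0 : v = 0 := Prod.ext e1 e2
    rw [hv0, map_zero] at e3
    exact zero_ne_one e3
  refine ⟨g₂ - g₁, fderiv ℝ H q (0, 0, 1), hg₂.sub hg₁, hκ, ?_, ?_, ?_, ?_, ?_⟩
  · intro h1 h2
    rw [hHd, h1, h2, show ((0 : ℝ), (0 : ℝ)) = 0 from rfl, map_zero, sub_zero]
  -- Strict differentiability is needed because `H` is compared at two moving points, those of the
  -- two graphs over `z`.
  · have hstrict := (hHs.hasStrictFDerivAt (by simp)).isLittleO
    have hc₁ : Tendsto (fun z : ℝ × ℝ => ((z.1, z.2, f₁ z) : VarPt)) (𝓝 z₀) (𝓝 q) := by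
      have := (hasFDerivAt_graph hf₁).continuousAt.tendsto
      simpa [← hz₀, hq₁] using this
    have hc₂ : Tendsto (fun z : ℝ × ℝ => ((z.1, z.2, f₂ z) : VarPt)) (𝓝 z₀) (𝓝 q) := by
      have := (hasFDerivAt_graph hf₂).continuousAt.tendsto
      simpa [← hz₀, hq₂] using this
    have h := hstrict.comp_tendsto (hc₂.prodMk_nhds hc₁)
    have h' : (fun z => (g₂ - g₁) (baseImage F f₂ z) - fderiv ℝ H q (0, 0, 1) * (f₂ z - f₁ z))
        =o[𝓝 z₀] fun z => ((0, 0, f₂ z - f₁ z) : VarPt) := by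
      refine h.congr' ?_ (Eventually.of_forall fun z => by simp)
      filter_upwards [hH₁, hH₂] with z h1 h2
      simp only [Function.comp_apply, h1, h2, Prod.mk_sub_mk, sub_self, sub_zero]
      rw [hvert (f₂ z - f₁ z)]
    refine h'.trans_isBigO (IsBigO.of_bound 1 (Eventually.of_forall fun z => ?_))
    simp [Prod.norm_def]
  · intro v
    have h1 := hasFDerivAt_comp_graph (hHs.differentiableAt (by simp)) hf₁ hq₁
    have h2 := hasFDerivAt_comp_graph (hHs.differentiableAt (by simp)) hf₂ hq₂
    have h1' := (h1.congr_of_eventuallyEq (f₁ := fun _ => (0 : ℝ))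
      (hH₁.mono fun z hz => hz.symm)).unique (hasFDerivAt_const 0 _)
    have hb : HasFDerivAt (baseImage F f₂) (fderiv ℝ (baseImage F f₂) z₀) z₀ :=
      ((contDiffAt_baseImage hF hf₂ hq₂).differentiableAt (by simp)).hasFDerivAt
    have hd : HasFDerivAt (g₂ - g₁) (fderiv ℝ (g₂ - g₁) y₀) (baseImage F f₂ z₀) := by
      rw [baseImage_self hq₂]
      exact ((hg₂.sub hg₁).differentiableAt (by simp)).hasFDerivAt
    have h3 := (hd.comp z₀ hb).congr_of_eventuallyEq (hH₂.mono fun z hz => hz.symm)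
    have h4 := DFunLike.congr_fun (h3.unique h2) v
    have h5 := DFunLike.congr_fun h1' v
    simp only [ContinuousLinearMap.comp_apply, ContinuousLinearMap.prod_apply,
      ContinuousLinearMap.coe_fst', ContinuousLinearMap.coe_snd', zero_apply]
      at h4 h5
    have h6 : ((v.1, v.2, fderiv ℝ f₂ z₀ v) : VarPt) - (v.1, v.2, fderiv ℝ f₁ z₀ v)
        = (0, 0, fderiv ℝ f₂ z₀ v - fderiv ℝ f₁ z₀ v) := by simp
    rw [h4, ← hvert, ← h6, map_sub, h5, sub_zero]
  · filter_upwards [he₁, he₂] with z h1 h2 h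
    rw [Pi.sub_apply, h2, ← h, h1]
  · have := lhs_sub_lhs (n := n') (β := β') (σ := σ') hg₁ hg₂ (hv₁.trans hv₂.symm)
    rw [hl₁', hl₂', sub_zero, hv₂] at this
    exact this.symm

end Prolongation
end Jets
-- The new time depends on the old time only.
section Determining

open Asymptotics

theorem isLittleO_pow_sub_pow {θ : ℝ → ℝ} {x d : ℝ} (hθ : HasDerivAt θ d x) (hd : d ≠ 0)
    (h0 : θ x = 0) (k : ℕ) :
    (fun z => θ z ^ k - d ^ k * (z - x) ^ k) =o[𝓝 x] fun z => (z - x) ^ k := by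
  have hlin : (fun z => θ z - d * (z - x)) =o[𝓝 x] fun z => z - x := by
    simpa [h0, mul_comm] using hθ.isLittleO
  have heq : IsEquivalent (𝓝 x) θ (fun z => d * (z - x)) :=
    hlin.trans_isBigO (isBigO_self_const_mul hd _ _)
  have := (heq.pow k).isLittleO
  simp only [Pi.pow_def, Pi.sub_def, mul_pow] at this
  exact this.trans_isBigO (isBigO_const_mul_self _ _ _)

theorem iteratedDeriv_of_isLittleO_quintic {f χ : ℝ → ℝ} {x y d c₀ c₁ c₃ c₄ c₅ : ℝ}
    (hχ : HasDerivAt χ d x) (hd : d ≠ 0) (hy : χ x = y) (hf : ContDiffAt ℝ ∞ f y)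
    (h : (fun z => f (χ z) - (c₀ + c₁ * (χ z - y) + c₃ * (χ z - y) ^ 3 + c₄ * (χ z - y) ^ 4
      + c₅ * (χ z - y) ^ 5)) =o[𝓝 x] fun z => (z - x) ^ 5) :
    iteratedDeriv 1 f y = c₁ ∧ iteratedDeriv 3 f y = 6 * c₃ ∧ iteratedDeriv 5 f y = 120 * c₅ := by
  have hg : ContDiffAt ℝ ∞ (fun z => c₀ + c₁ * (z - y) + c₃ * (z - y) ^ 3 + c₄ * (z - y) ^ 4
      + c₅ * (z - y) ^ 5) y := by fun_prop
  have hk := fun j hj => iteratedDeriv_eq_of_isLittleO_comp (j := j) hχ hd hy hf hg h hj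
  rw [hk 1 (by norm_num), hk 3 (by norm_num), hk 5 le_rfl]
  exact iteratedDeriv_quintic c₀ c₁ c₃ c₄ c₅ y

/-- Two nonzero affine functions do not vanish everywhere simultaneously in product. When `A₁ = 0`
the product is a quadratic polynomial in `γ`, and its zeros at `0, 1, -1` kill all its coefficients.
-/
theorem exists_affine_ne_zero {A₀ A₁ A₂ p r : ℝ} (hA : A₀ ≠ 0 ∨ A₁ ≠ 0 ∨ A₂ ≠ 0)
    (hp : p ≠ 0 ∨ r ≠ 0) : ∃ α γ : ℝ, A₀ + A₁ * α + A₂ * γ ≠ 0 ∧ p + r * γ ≠ 0 := by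
  by_cases hA1 : A₁ = 0
  · subst hA1
    by_contra! hcon
    have key : ∀ γ : ℝ, (A₀ + A₂ * γ) * (p + r * γ) = 0 := by
      intro γ
      by_cases h : A₀ + A₂ * γ = 0
      · rw [h, zero_mul]
      · rw [hcon 0 γ (by simpa using h), mul_zero]
    have k0 := key 0
    have k1 := key 1
    have k2 := key (-1)
    have e0 : A₀ * p = 0 := by linarith
    have e2 : A₂ * r = 0 := by linarith
    have e1 : A₀ * r + A₂ * p = 0 := by linarith
    rcases mul_eq_zero.1 e0 with h | h <;> rcases mul_eq_zero.1 e2 with h' | h' <;> simp_all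
  · obtain ⟨γ, hγ⟩ : ∃ γ : ℝ, p + r * γ ≠ 0 := by
      by_cases h : p = 0
      · exact ⟨1, by simpa [h] using hp⟩
      · exact ⟨0, by simpa using h⟩
    by_cases h : A₀ + A₂ * γ = 0
    · exact ⟨1, γ, fun h' => hA1 (by linarith), hγ⟩
    · exact ⟨0, γ, by simpa using h, hγ⟩

theorem map_triple (L : VarPt →L[ℝ] VarPt) (a b c : ℝ) :
    L (a, b, c) = a • L (1, 0, 0) + b • L (0, 1, 0) + c • L (0, 0, 1) := by
  rw [← map_smul, ← map_smul, ← map_smul, ← map_add, ← map_add]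
  simp

variable {F : VarPt → VarPt} {q : VarPt} {n n' : ℤ} {β σ β' σ' : ℝ → ℝ}

theorem fderiv_baseImage_testFn (hF : ContDiffAt ℝ ∞ F q) (α γ c₃ c₄ c₅ d : ℝ) (v : ℝ × ℝ) :
    fderiv ℝ (baseImage F (testFn q α γ c₃ c₄ c₅ d)) (q.1, q.2.1) v =
      (((fderiv ℝ F q (1, 0, 0)).1 + (fderiv ℝ F q (0, 0, 1)).1 * α) * v.1
        + ((fderiv ℝ F q (0, 1, 0)).1 + (fderiv ℝ F q (0, 0, 1)).1 * γ) * v.2,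
      ((fderiv ℝ F q (1, 0, 0)).2.1 + (fderiv ℝ F q (0, 0, 1)).2.1 * α) * v.1
        + ((fderiv ℝ F q (0, 1, 0)).2.1 + (fderiv ℝ F q (0, 0, 1)).2.1 * γ) * v.2) := by
  rw [fderiv_baseImage hF (contDiff_testFn ..).contDiffAt (testFn_self ..), fderiv_testFn,
    map_triple]
  simp only [Prod.fst_add, Prod.snd_add, Prod.smul_fst, Prod.smul_snd, smul_eq_mul]
  ext <;> simp only <;> ring

theorem isInvertible_fderiv_baseImage_testFn (hF : ContDiffAt ℝ ∞ F q) {α γ c₃ c₄ c₅ d : ℝ}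
    (hdet : ((fderiv ℝ F q (1, 0, 0)).1 + (fderiv ℝ F q (0, 0, 1)).1 * α)
        * ((fderiv ℝ F q (0, 1, 0)).2.1 + (fderiv ℝ F q (0, 0, 1)).2.1 * γ)
      - ((fderiv ℝ F q (0, 1, 0)).1 + (fderiv ℝ F q (0, 0, 1)).1 * γ)
        * ((fderiv ℝ F q (1, 0, 0)).2.1 + (fderiv ℝ F q (0, 0, 1)).2.1 * α) ≠ 0) :
    (fderiv ℝ (baseImage F (testFn q α γ c₃ c₄ c₅ d)) (q.1, q.2.1)).IsInvertible := by
  refine isInvertible_of_injective _ fun v hv => ?_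
  rw [fderiv_baseImage_testFn hF] at hv
  obtain ⟨h1, h2⟩ := Prod.mk.inj hv
  refine Prod.ext (mul_left_cancel₀ hdet ?_) (mul_left_cancel₀ hdet ?_)
  · simp only [Prod.fst_zero, mul_zero]
    linear_combination ((fderiv ℝ F q (0, 1, 0)).2.1 + (fderiv ℝ F q (0, 0, 1)).2.1 * γ) * h1
      - ((fderiv ℝ F q (0, 1, 0)).1 + (fderiv ℝ F q (0, 0, 1)).1 * γ) * h2
  · simp only [Prod.snd_zero, mul_zero]
    linear_combination ((fderiv ℝ F q (1, 0, 0)).1 + (fderiv ℝ F q (0, 0, 1)).1 * α) * h2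
      - ((fderiv ℝ F q (1, 0, 0)).2.1 + (fderiv ℝ F q (0, 0, 1)).2.1 * α) * h1

/-- The new time does not depend on `x` and `u`. -/
theorem time_component_fderiv (hF : ContDiffAt ℝ ∞ F q) (hinv : (fderiv ℝ F q).IsInvertible)
    (hσ : σ q.1 ≠ 0) (hσ' : σ' (F q).1 ≠ 0) (hmap : MapsEquationAt F q n β σ n' β' σ') :
    (fderiv ℝ F q (0, 1, 0)).1 = 0 ∧ (fderiv ℝ F q (0, 0, 1)).1 = 0 := by
  by_contra hcon
  have hp : (fderiv ℝ F q (0, 1, 0)).1 ≠ 0 ∨ (fderiv ℝ F q (0, 0, 1)).1 ≠ 0 := by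
    by_contra! h
    exact hcon h
  set Tt := (fderiv ℝ F q (1, 0, 0)).1 with hTt
  set Tx := (fderiv ℝ F q (0, 1, 0)).1 with hTx
  set Tu := (fderiv ℝ F q (0, 0, 1)).1 with hTu
  set Xt := (fderiv ℝ F q (1, 0, 0)).2.1 with hXt
  set Xx := (fderiv ℝ F q (0, 1, 0)).2.1 with hXx
  set Xu := (fderiv ℝ F q (0, 0, 1)).2.1 with hXu
  -- The differential of `(T, X)` has rank two because `dF` is invertible. These minors are the
  -- coefficients of the Jacobian of `(T, X)` along a graph, which is affine in `u_t = α`, `u_x = γ`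
  -- since the `αγ` terms cancel.
  have hminors : Tt * Xx - Tx * Xt ≠ 0 ∨ Tu * Xx - Tx * Xu ≠ 0 ∨ Tt * Xu - Tu * Xt ≠ 0 := by
    by_contra! h
    obtain ⟨h1, h2, h3⟩ := h
    obtain ⟨v, hv⟩ := hinv.surjective (1, 0, 0)
    obtain ⟨w, hw⟩ := hinv.surjective (0, 1, 0)
    have hv' := map_triple (fderiv ℝ F q) v.1 v.2.1 v.2.2
    have hw' := map_triple (fderiv ℝ F q) w.1 w.2.1 w.2.2
    rw [hv] at hv'
    rw [hw] at hw'
    have a1 := congrArg Prod.fst hv'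
    have a2 := congrArg (fun r => r.2.1) hv'
    have b1 := congrArg Prod.fst hw'
    have b2 := congrArg (fun r => r.2.1) hw'
    simp only [Prod.fst_add, Prod.snd_add, Prod.smul_fst, Prod.smul_snd, smul_eq_mul,
      ← hTt, ← hTx, ← hTu, ← hXt, ← hXx, ← hXu] at a1 a2 b1 b2
    have : (1 : ℝ) = 0 := by
      calc (1 : ℝ) = 1 * 1 - 0 * 0 := by norm_num
        _ = (v.1 * Tt + v.2.1 * Tx + v.2.2 * Tu) * (w.1 * Xt + w.2.1 * Xx + w.2.2 * Xu)
            - (v.1 * Xt + v.2.1 * Xx + v.2.2 * Xu) * (w.1 * Tt + w.2.1 * Tx + w.2.2 * Tu) := by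
          rw [← a1, ← a2, ← b1, ← b2]
        _ = 0 := by
          linear_combination (v.1 * w.2.1 - v.2.1 * w.1) * h1 - (v.2.1 * w.2.2 - v.2.2 * w.2.1) * h2
            + (v.1 * w.2.2 - v.2.2 * w.1) * h3
    exact one_ne_zero this
  obtain ⟨α, γ, hdet, hd⟩ := exists_affine_ne_zero hminors hp
  have hdet' : (Tt + Tu * α) * (Xx + Xu * γ) - (Tx + Tu * γ) * (Xt + Xu * α) ≠ 0 := by
    intro h
    exact hdet (by linear_combination h)
  -- The coefficient of `(x - x₀) ^ 5` is chosen to make the jet a solution jet. The term `d (t -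
  -- t₀) ^ 5` does not contribute to the equation, so `d = 0` and `d = 1` are both allowed.
  set e := -(α + q.2.2 ^ n * γ) / (120 * σ q.1) with he
  have hl : ∀ d, lhs n β σ (testFn q α γ 0 0 e d) q.1 q.2.1 = 0 := by
    intro d
    rw [lhs_testFn, he]
    field_simp
    ring
  have hP : ∀ d, (fderiv ℝ (baseImage F (testFn q α γ 0 0 e d)) (q.1, q.2.1)).IsInvertible :=
    fun d => isInvertible_fderiv_baseImage_testFn hF hdet'
  obtain ⟨Δ, κ, hΔ, hκ, -, hasy, hder, -, hpde⟩ := exists_image_difference hF hinv hmap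
    (contDiff_testFn q α γ 0 0 e 0).contDiffAt (contDiff_testFn q α γ 0 0 e 1).contDiffAt
    (testFn_self ..) (testFn_self ..) (hP 0) (hP 1) (hl 0) (hl 1)
  set f₂ := testFn q α γ 0 0 e 1 with hf₂
  have hq₂ : f₂ (q.1, q.2.1) = q.2.2 := testFn_self ..
  have hΔt : fderiv ℝ Δ ((F q).1, (F q).2.1) (1, 0) = 0 := by
    obtain ⟨v, hv⟩ := (hP 1).surjective (1, 0)
    rw [← hv, hder, fderiv_testFn, fderiv_testFn, sub_self, mul_zero]
  have hPs := contDiffAt_baseImage hF (contDiff_testFn q α γ 0 0 e 1).contDiffAt hq₂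
  obtain ⟨ψ, hψ, hψ0, hr, -⟩ := exists_local_inverse hPs (hP 1)
  rw [← hf₂, baseImage_self hq₂] at hψ hψ0 hr
  have hline : HasDerivAt (fun ξ : ℝ => ((F q).1, ξ)) ((0 : ℝ), (1 : ℝ)) (F q).2.1 :=
    (hasDerivAt_const _ _).prodMk (hasDerivAt_id _)
  have hψd : HasDerivAt (fun ξ : ℝ => ψ ((F q).1, ξ))
      (fderiv ℝ ψ ((F q).1, (F q).2.1) (0, 1)) (F q).2.1 :=
    (hψ.differentiableAt (by simp)).hasFDerivAt.comp_hasDerivAt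
      (f := fun ξ : ℝ => ((F q).1, ξ)) _ hline
  -- `v` is the old direction along which the new time is stationary and the new `x` has unit speed.
  -- By the choice of `γ` it is transversal to `t = const`, so on the line of constant new time `Δ`
  -- is asymptotic to `κ v.1 ^ 5 (ξ - x̃₀) ^ 5`, where `x̃₀ = (F q).2.1`. Only the `σ'` term of the
  -- linear equation then survives.
  set v := fderiv ℝ ψ ((F q).1, (F q).2.1) (0, 1) with hv
  have hr' : ∀ᶠ ξ in 𝓝 (F q).2.1, baseImage F f₂ (ψ ((F q).1, ξ)) = ((F q).1, ξ) :=
    hline.continuousAt.eventually hr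
  have hPv : fderiv ℝ (baseImage F f₂) (q.1, q.2.1) v = (0, 1) := by
    have h1 : HasFDerivAt (baseImage F f₂) (fderiv ℝ (baseImage F f₂) (q.1, q.2.1))
        (ψ ((F q).1, (F q).2.1)) := by
      rw [hψ0]; exact (hPs.differentiableAt (by simp)).hasFDerivAt
    have h2 := h1.comp_hasDerivAt (f := fun ξ : ℝ => ψ ((F q).1, ξ)) _ hψd
    exact (h2.congr_of_eventuallyEq (hr'.mono fun ξ h => h.symm)).unique hline
  have hv1 : v.1 ≠ 0 := by
    intro h0
    rw [hf₂, fderiv_baseImage_testFn hF] at hPv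
    obtain ⟨p1, p2⟩ := Prod.mk.inj hPv
    rw [h0, mul_zero, zero_add] at p1 p2
    have h3 : v.2 = 0 := (mul_eq_zero.1 p1).resolve_left hd
    rw [h3, mul_zero] at p2
    exact zero_ne_one p2
  have hθ : HasDerivAt (fun ξ => (ψ ((F q).1, ξ)).1 - q.1) v.1 (F q).2.1 := hψd.fst.sub_const _
  have hpow := isLittleO_pow_sub_pow hθ hv1 (by simp [hψ0]) 5
  have hdiff : ∀ z, f₂ z - testFn q α γ 0 0 e 0 z = (z.1 - q.1) ^ 5 := by
    intro z
    simp only [hf₂, testFn]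
    ring
  have htend : Tendsto (fun ξ : ℝ => ψ ((F q).1, ξ)) (𝓝 (F q).2.1) (𝓝 (q.1, q.2.1)) := by
    have := hψd.continuousAt.tendsto
    rwa [hψ0] at this
  have hasy' := hasy.comp_tendsto htend
  have hO : (fun ξ : ℝ => ((ψ ((F q).1, ξ)).1 - q.1) ^ 5) =O[𝓝 (F q).2.1]
      fun ξ => (ξ - (F q).2.1) ^ 5 := by
    have := hθ.differentiableAt.isBigO_sub
    simp only [hψ0, sub_self, sub_zero] at this
    exact this.pow 5
  have hfin : (fun ξ => Δ ((F q).1, ξ) - (0 + 0 * (ξ - (F q).2.1) + 0 * (ξ - (F q).2.1) ^ 3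
      + 0 * (ξ - (F q).2.1) ^ 4 + κ * v.1 ^ 5 * (ξ - (F q).2.1) ^ 5)) =o[𝓝 (F q).2.1]
      fun ξ => (ξ - (F q).2.1) ^ 5 := by
    have h1 : (fun ξ => Δ ((F q).1, ξ) - κ * ((ψ ((F q).1, ξ)).1 - q.1) ^ 5) =o[𝓝 (F q).2.1]
        fun ξ => (ξ - (F q).2.1) ^ 5 := by
      refine (hasy'.congr' ?_ ?_).trans_isBigO hO
      · filter_upwards [hr'] with ξ hξ
        simp only [Function.comp_apply, hξ, hdiff]
      · exact Eventually.of_forall fun ξ => by simp only [Function.comp_apply, hdiff]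
    refine (h1.add (hpow.const_mul_left κ)).congr_left fun ξ => by ring
  obtain ⟨e1, e3, e5⟩ := iteratedDeriv_of_isLittleO_quintic (hasDerivAt_id _) one_ne_zero rfl
    (contDiffAt_slice hΔ) hfin
  rw [id] at e1 e3 e5
  rw [e1, e3, e5, hΔt] at hpde
  have : σ' (F q).1 * (120 * (κ * v.1 ^ 5)) ≠ 0 :=
    mul_ne_zero hσ' (mul_ne_zero (by norm_num) (mul_ne_zero hκ (pow_ne_zero _ hv1)))
  apply this
  linarith

end Determining
-- The new space variable is affine in `x`, with slope depending on `t` only.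
section Slices

open Asymptotics

theorem fderiv_apply_eq_of_eventuallyEq {E : Type*} [NormedAddCommGroup E] [NormedSpace ℝ E]
    {G : E → ℝ} {a b v : E} (ha : DifferentiableAt ℝ G a) (hb : DifferentiableAt ℝ G b)
    (h : ∀ᶠ s : ℝ in 𝓝 0, G (a + s • v) = G (b + s • v)) : fderiv ℝ G a v = fderiv ℝ G b v := by
  have h1 : HasDerivAt (fun s : ℝ => G (a + s • v)) (fderiv ℝ G a v) 0 :=
    ha.hasFDerivAt.hasLineDerivAt v
  have h2 : HasDerivAt (fun s : ℝ => G (b + s • v)) (fderiv ℝ G b v) 0 :=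
    hb.hasFDerivAt.hasLineDerivAt v
  exact (h1.congr_of_eventuallyEq (h.mono fun s hs => hs.symm)).unique h2

theorem eventually_add_smul_mem {E : Type*} [NormedAddCommGroup E] [NormedSpace ℝ E]
    {W : Set E} (hW : IsOpen W) {a : E} (ha : a ∈ W) (v : E) : ∀ᶠ s : ℝ in 𝓝 0, a + s • v ∈ W := by
  have : ContinuousAt (fun s : ℝ => a + s • v) 0 := by fun_prop
  exact this.eventually_mem (hW.mem_nhds (by simpa using ha))

theorem map_pair (ℓ : ℝ × ℝ →L[ℝ] ℝ) (r s : ℝ) : ℓ (r, s) = r * ℓ (1, 0) + s * ℓ (0, 1) := by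
  rw [← smul_eq_mul, ← smul_eq_mul, ← map_smul, ← map_smul, ← map_add]
  simp

variable {F : VarPt → VarPt} {q q' : VarPt} {n n' : ℤ} {β σ β' σ' : ℝ → ℝ}

theorem fderiv_fst_comp (hF : DifferentiableAt ℝ F q) (v : VarPt) :
    fderiv ℝ (fun r => (F r).1) q v = (fderiv ℝ F q v).1 := by
  rw [hF.hasFDerivAt.fst.fderiv]; rfl

theorem fderiv_snd_fst_comp (hF : DifferentiableAt ℝ F q) (v : VarPt) :
    fderiv ℝ (fun r => (F r).2.1) q v = (fderiv ℝ F q v).2.1 := by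
  rw [hF.hasFDerivAt.snd.fst.fderiv]; rfl

theorem fderiv_snd_snd_comp (hF : DifferentiableAt ℝ F q) (v : VarPt) :
    fderiv ℝ (fun r => (F r).2.2) q v = (fderiv ℝ F q v).2.2 := by
  rw [hF.hasFDerivAt.snd.snd.fderiv]; rfl

theorem time_fderiv_ne_zero (hinv : (fderiv ℝ F q).IsInvertible)
    (hTx : (fderiv ℝ F q (0, 1, 0)).1 = 0) (hTu : (fderiv ℝ F q (0, 0, 1)).1 = 0) :
    (fderiv ℝ F q (1, 0, 0)).1 ≠ 0 := by
  intro h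
  obtain ⟨v, hv⟩ := hinv.surjective (1, 0, 0)
  have := map_triple (fderiv ℝ F q) v.1 v.2.1 v.2.2
  rw [hv] at this
  have := congrArg Prod.fst this
  simp [h, hTx, hTu] at this

/-- The transformation of `σ`, with the derivative of the new `x` along a jet with `u_x = γ`. -/
theorem sigma_transform (hF : ContDiffAt ℝ ∞ F q) (hinv : (fderiv ℝ F q).IsInvertible)
    (hmap : MapsEquationAt F q n β σ n' β' σ')
    (hTx : (fderiv ℝ F q (0, 1, 0)).1 = 0) (hTu : (fderiv ℝ F q (0, 0, 1)).1 = 0)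
    (hT : ∀ᶠ r in 𝓝 q, r.1 = q.1 → (F r).1 = (F q).1) {γ : ℝ}
    (hd : (fderiv ℝ F q (0, 1, 0)).2.1 + (fderiv ℝ F q (0, 0, 1)).2.1 * γ ≠ 0) :
    σ' (F q).1 * (fderiv ℝ F q (1, 0, 0)).1
      = σ q.1 * ((fderiv ℝ F q (0, 1, 0)).2.1 + (fderiv ℝ F q (0, 0, 1)).2.1 * γ) ^ 5 := by
  set d := (fderiv ℝ F q (0, 1, 0)).2.1 + (fderiv ℝ F q (0, 0, 1)).2.1 * γ with hddef
  have hTt := time_fderiv_ne_zero hinv hTx hTu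
  set Tt := (fderiv ℝ F q (1, 0, 0)).1 with hTtdef
  set α := -(q.2.2 ^ n * γ) with hα
  have hP : ∀ α c, (fderiv ℝ (baseImage F (testFn q α γ 0 0 c 0)) (q.1, q.2.1)).IsInvertible := by
    intro α c
    refine isInvertible_fderiv_baseImage_testFn hF ?_
    rw [hTx, hTu, ← hddef, ← hTtdef]
    simpa using ⟨hTt, hd⟩
  obtain ⟨Δ, κ, hΔ, hκ, -, hasy, hder, -, hpde⟩ := exists_image_difference hF hinv hmap
    (contDiff_testFn q α γ 0 0 0 0).contDiffAt
    (contDiff_testFn q (α - 120 * σ q.1) γ 0 0 1 0).contDiffAt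
    (testFn_self ..) (testFn_self ..) (hP _ _) (hP _ _)
    (by rw [lhs_testFn, hα]; ring) (by rw [lhs_testFn, hα]; ring)
  set f₂ := testFn q (α - 120 * σ q.1) γ 0 0 1 0 with hf₂
  have hline : HasDerivAt (fun x : ℝ => (q.1, x)) ((0 : ℝ), (1 : ℝ)) q.2.1 :=
    (hasDerivAt_const _ _).prodMk (hasDerivAt_id _)
  have hχ : HasDerivAt (fun x => (baseImage F f₂ (q.1, x)).2) d q.2.1 := by
    have h1 : HasFDerivAt (baseImage F f₂) (fderiv ℝ (baseImage F f₂) (q.1, q.2.1)) (q.1, q.2.1) :=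
      ((contDiffAt_baseImage hF (contDiff_testFn ..).contDiffAt
        (testFn_self ..)).differentiableAt (by simp)).hasFDerivAt
    have h2 : HasDerivAt (fun x => baseImage F f₂ (q.1, x))
        (fderiv ℝ (baseImage F f₂) (q.1, q.2.1) (0, 1)) q.2.1 :=
      h1.comp_hasDerivAt (f := fun x : ℝ => (q.1, x)) _ hline
    have h3 : HasDerivAt (fun x => (baseImage F f₂ (q.1, x)).2)
        (fderiv ℝ (baseImage F f₂) (q.1, q.2.1) (0, 1)).2 q.2.1 := h2.snd
    refine h3.congr_deriv ?_
    rw [hf₂, fderiv_baseImage_testFn hF]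
    simp [hddef]
  have hχ0 : (baseImage F f₂ (q.1, q.2.1)).2 = (F q).2.1 := by
    rw [baseImage_self (testFn_self ..)]
  have htime : ∀ᶠ x in 𝓝 q.2.1, baseImage F f₂ (q.1, x)
      = ((F q).1, (baseImage F f₂ (q.1, x)).2) := by
    have hc : ContinuousAt (fun x : ℝ => ((q.1, x, f₂ (q.1, x)) : VarPt)) q.2.1 := by
      have := (contDiff_testFn q (α - 120 * σ q.1) γ 0 0 1 0).continuous
      fun_prop
    have h0 : ((q.1, q.2.1, f₂ (q.1, q.2.1)) : VarPt) = q := by rw [hf₂, testFn_self]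
    have h1 := hc.tendsto
    rw [h0] at h1
    filter_upwards [h1.eventually hT] with x hx
    exact Prod.ext (hx rfl) rfl
  have hpow := isLittleO_pow_sub_pow (hχ.sub_const (F q).2.1) hd (by rw [hχ0, sub_self]) 5
  have hdiff : ∀ x, f₂ (q.1, x) - testFn q α γ 0 0 0 0 (q.1, x) = (x - q.2.1) ^ 5 := by
    intro x
    simp only [hf₂, testFn]
    ring
  have hasy' := hasy.comp_tendsto hline.continuousAt.tendsto
  have hfin : (fun x => Δ ((F q).1, (baseImage F f₂ (q.1, x)).2)
      - (0 + 0 * ((baseImage F f₂ (q.1, x)).2 - (F q).2.1)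
      + 0 * ((baseImage F f₂ (q.1, x)).2 - (F q).2.1) ^ 3
      + 0 * ((baseImage F f₂ (q.1, x)).2 - (F q).2.1) ^ 4
      + κ / d ^ 5 * ((baseImage F f₂ (q.1, x)).2 - (F q).2.1) ^ 5)) =o[𝓝 q.2.1]
      fun x => (x - q.2.1) ^ 5 := by
    have h1 : (fun x => Δ ((F q).1, (baseImage F f₂ (q.1, x)).2) - κ * (x - q.2.1) ^ 5)
        =o[𝓝 q.2.1] fun x => (x - q.2.1) ^ 5 := by
      refine hasy'.congr' ?_ ?_
      · filter_upwards [htime] with x hx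
        simp only [Function.comp_apply, hdiff]
        rw [← hx]
      · exact Eventually.of_forall fun x => by simp only [Function.comp_apply, hdiff]
    refine (h1.sub (hpow.const_mul_left (κ / d ^ 5))).congr_left fun x => ?_
    field_simp
    ring
  obtain ⟨e1, e3, e5⟩ := iteratedDeriv_of_isLittleO_quintic (f := fun ξ => Δ ((F q).1, ξ))
    hχ hd hχ0 (contDiffAt_slice hΔ) hfin
  have hx0 : fderiv ℝ Δ ((F q).1, (F q).2.1) (0, 1) = 0 := by
    rw [← deriv_snd_slice (hΔ.differentiableAt (by simp)), ← iteratedDeriv_one]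
    exact e1
  have ht := hder (1, 0)
  rw [fderiv_testFn, fderiv_baseImage_testFn hF, fderiv_testFn, hTu, ← hTtdef] at ht
  simp only [zero_mul, add_zero, mul_one, mul_zero] at ht
  rw [map_pair, hx0, mul_zero, add_zero] at ht
  rw [e1, e3, e5] at hpde
  have h5 : d ^ 5 ≠ 0 := pow_ne_zero _ hd
  have h6 : 120 * κ / d ^ 5 * (σ' (F q).1 * Tt - σ q.1 * d ^ 5) = 0 := by
    have : 120 * κ / d ^ 5 * (σ q.1 * d ^ 5) = 120 * κ * σ q.1 := by field_simp
    rw [mul_sub, this]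
    linear_combination Tt * hpde - ht
  have h7 : 120 * κ / d ^ 5 ≠ 0 := div_ne_zero (mul_ne_zero (by norm_num) hκ) h5
  exact sub_eq_zero.1 ((mul_eq_zero.1 h6).resolve_left h7)

/-- On the convex open set `W`, the transformation `F` is nondegenerate and maps the equation with
arbitrary elements `n, β, σ` to the one with `n', β', σ'`. -/
structure MapsEquationOn (F : VarPt → VarPt) (W : Set VarPt) (n n' : ℤ) (β σ β' σ' : ℝ → ℝ) :
    Prop where
  isOpen : IsOpen W
  convex : Convex ℝ W
  contDiffAt : ∀ q ∈ W, ContDiffAt ℝ ∞ F q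
  invertible : ∀ q ∈ W, (fderiv ℝ F q).IsInvertible
  sigma_ne_zero : ∀ q ∈ W, σ q.1 ≠ 0
  new_sigma_ne_zero : ∀ q ∈ W, σ' (F q).1 ≠ 0
  maps : ∀ q ∈ W, MapsEquationAt F q n β σ n' β' σ'

namespace MapsEquationOn

variable {W : Set VarPt} (h : MapsEquationOn F W n n' β σ β' σ')
include h

theorem differentiableAt (hq : q ∈ W) : DifferentiableAt ℝ F q :=
  (h.contDiffAt q hq).differentiableAt (by simp)

theorem time_fderiv (hq : q ∈ W) :
    (fderiv ℝ F q (0, 1, 0)).1 = 0 ∧ (fderiv ℝ F q (0, 0, 1)).1 = 0 :=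
  time_component_fderiv (h.contDiffAt q hq) (h.invertible q hq) (h.sigma_ne_zero q hq)
    (h.new_sigma_ne_zero q hq) (h.maps q hq)

theorem time_fderiv_ne (hq : q ∈ W) : (fderiv ℝ F q (1, 0, 0)).1 ≠ 0 :=
  time_fderiv_ne_zero (h.invertible q hq) (h.time_fderiv hq).1 (h.time_fderiv hq).2

theorem time_eq (hq : q ∈ W) (hq' : q' ∈ W) (ht : q'.1 = q.1) : (F q').1 = (F q).1 := by
  refine eq_of_fderiv_eq_zero_along (G := fun r => (F r).1) h.convex
    (fun r hr => (h.differentiableAt hr).fst) hq hq' fun r hr => ?_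
  have he : q' - q = (0, (q' - q).2.1, (q' - q).2.2) :=
    Prod.ext (sub_eq_zero.2 ht) rfl
  rw [fderiv_fst_comp (h.differentiableAt hr), he, map_triple]
  simp [(h.time_fderiv hr).1, (h.time_fderiv hr).2]

theorem time_fderiv_eq (hq : q ∈ W) (hq' : q' ∈ W) (ht : q'.1 = q.1) :
    (fderiv ℝ F q' (1, 0, 0)).1 = (fderiv ℝ F q (1, 0, 0)).1 := by
  rw [← fderiv_fst_comp (h.differentiableAt hq), ← fderiv_fst_comp (h.differentiableAt hq')]
  refine fderiv_apply_eq_of_eventuallyEq (h.differentiableAt hq').fst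
    (h.differentiableAt hq).fst ?_
  filter_upwards [eventually_add_smul_mem h.isOpen hq' (1, 0, 0),
    eventually_add_smul_mem h.isOpen hq (1, 0, 0)] with s h1 h2
  exact h.time_eq h2 h1 (by simp [ht])

theorem sigma_eq (hq : q ∈ W) {γ : ℝ}
    (hd : (fderiv ℝ F q (0, 1, 0)).2.1 + (fderiv ℝ F q (0, 0, 1)).2.1 * γ ≠ 0) :
    σ' (F q).1 * (fderiv ℝ F q (1, 0, 0)).1
      = σ q.1 * ((fderiv ℝ F q (0, 1, 0)).2.1 + (fderiv ℝ F q (0, 0, 1)).2.1 * γ) ^ 5 :=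
  sigma_transform (h.contDiffAt q hq) (h.invertible q hq) (h.maps q hq) (h.time_fderiv hq).1
    (h.time_fderiv hq).2
    ((h.isOpen.eventually_mem hq).mono fun _ hr ht => h.time_eq hq hr ht) hd

/-- If `X_u ≠ 0`, then `X_x + X_u γ` takes every real value as `γ` varies, while the left-hand side
of `sigma_eq` is fixed. The values `1` and `2` already force `σ = 32 σ`. -/
theorem space_fderiv_u (hq : q ∈ W) : (fderiv ℝ F q (0, 0, 1)).2.1 = 0 := by
  by_contra hne
  set Xx := (fderiv ℝ F q (0, 1, 0)).2.1 with hXx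
  set Xu := (fderiv ℝ F q (0, 0, 1)).2.1 with hXu
  have key : ∀ d : ℝ, d ≠ 0 →
      σ' (F q).1 * (fderiv ℝ F q (1, 0, 0)).1 = σ q.1 * d ^ 5 := by
    intro d hd
    have e : Xx + Xu * ((d - Xx) / Xu) = d := by field_simp; ring
    have := h.sigma_eq hq (γ := (d - Xx) / Xu) (by rw [← hXx, ← hXu, e]; exact hd)
    rwa [← hXx, ← hXu, e] at this
  have h1 := key 1 one_ne_zero
  have h2 := key 2 two_ne_zero
  apply h.sigma_ne_zero q hq
  linarith

theorem space_fderiv_ne (hq : q ∈ W) : (fderiv ℝ F q (0, 1, 0)).2.1 ≠ 0 := by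
  intro h0
  obtain ⟨v, hv⟩ := (h.invertible q hq).surjective (0, 1, 0)
  have h1 := map_triple (fderiv ℝ F q) v.1 v.2.1 v.2.2
  rw [hv] at h1
  have e1 := congrArg Prod.fst h1
  have e2 := congrArg (fun r => r.2.1) h1
  simp [(h.time_fderiv hq).1, (h.time_fderiv hq).2, h.time_fderiv_ne hq] at e1
  simp [e1, h0, h.space_fderiv_u hq] at e2

theorem sigma_eq' (hq : q ∈ W) :
    σ' (F q).1 * (fderiv ℝ F q (1, 0, 0)).1 = σ q.1 * (fderiv ℝ F q (0, 1, 0)).2.1 ^ 5 := by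
  have := h.sigma_eq hq (γ := 0) (by simpa using h.space_fderiv_ne hq)
  simpa using this

/-- Every other quantity in `sigma_eq'` depends on `t` only, and the real fifth power is injective.
-/
theorem space_fderiv_eq (hq : q ∈ W) (hq' : q' ∈ W) (ht : q'.1 = q.1) :
    (fderiv ℝ F q' (0, 1, 0)).2.1 = (fderiv ℝ F q (0, 1, 0)).2.1 := by
  have h1 := h.sigma_eq' hq
  have h2 := h.sigma_eq' hq'
  rw [h.time_eq hq hq' ht, h.time_fderiv_eq hq hq' ht, ht, h1] at h2
  have h3 := mul_left_cancel₀ (h.sigma_ne_zero q hq) h2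
  exact ((Odd.strictMono_pow (by decide : Odd 5)).injective h3).symm

theorem space_eq (hq : q ∈ W) (hq' : q' ∈ W) (ht : q'.1 = q.1) :
    (F q').2.1 = (F q).2.1 + (fderiv ℝ F q (0, 1, 0)).2.1 * (q'.2.1 - q.2.1) := by
  obtain ⟨z, hz, hzz⟩ := domain_mvt (f := fun r => (F r).2.1) (s := W ∩ {r | r.1 = q.1})
    (fun r hr => (h.differentiableAt hr.1).snd.fst.hasFDerivAt.hasFDerivWithinAt)
    (h.convex.inter ((convex_singleton q.1).linear_preimage (LinearMap.fst ℝ ℝ (ℝ × ℝ))))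
    ⟨hq, rfl⟩ ⟨hq', ht⟩
  have hzW : z ∈ W ∩ {r | r.1 = q.1} :=
    (h.convex.inter ((convex_singleton q.1).linear_preimage
      (LinearMap.fst ℝ ℝ (ℝ × ℝ)))).segment_subset ⟨hq, rfl⟩ ⟨hq', ht⟩ hz
  have he : q' - q = (0, (q' - q).2.1, (q' - q).2.2) := Prod.ext (sub_eq_zero.2 ht) rfl
  rw [fderiv_snd_fst_comp (h.differentiableAt hzW.1), he, map_triple] at hzz
  simp only [zero_smul, zero_add, Prod.snd_add, Prod.fst_add, Prod.smul_snd, Prod.smul_fst,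
    smul_eq_mul, h.space_fderiv_u hzW.1, mul_zero, add_zero,
    h.space_fderiv_eq hq hzW.1 hzW.2] at hzz
  simp only [Prod.snd_sub, Prod.fst_sub] at hzz
  linear_combination hzz

theorem unknown_fderiv_ne (hq : q ∈ W) : (fderiv ℝ F q (0, 0, 1)).2.2 ≠ 0 := by
  intro h0
  have h1 : fderiv ℝ F q (0, 0, 1) = 0 :=
    Prod.ext (h.time_fderiv hq).2 (Prod.ext (h.space_fderiv_u hq) h0)
  have h2 := (h.invertible q hq).injective (h1.trans (map_zero _).symm)
  simp at h2

end MapsEquationOn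
end Slices
-- The new unknown is a multiple of `u`, and the exponent is preserved.
section Rigidity

open Asymptotics

namespace MapsEquationOn

variable {F : VarPt → VarPt} {q q' : VarPt} {n n' : ℤ} {β σ β' σ' : ℝ → ℝ}
variable {W : Set VarPt} (h : MapsEquationOn F W n n' β σ β' σ')
include h

theorem eventually_testFn_mem (hq : q ∈ W) (α γ c₃ c₄ c₅ d : ℝ) :
    ∀ᶠ x in 𝓝 q.2.1, ((q.1, x, testFn q α γ c₃ c₄ c₅ d (q.1, x)) : VarPt) ∈ W := by
  have hc : ContinuousAt (fun x : ℝ => ((q.1, x, testFn q α γ c₃ c₄ c₅ d (q.1, x)) : VarPt))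
      q.2.1 := by
    have := (contDiff_testFn q α γ c₃ c₄ c₅ d).continuous
    fun_prop
  refine hc.eventually_mem (h.isOpen.mem_nhds ?_)
  rwa [testFn_self]

theorem isInvertible_fderiv_baseImage (hq : q ∈ W) (α γ c₃ c₄ c₅ d : ℝ) :
    (fderiv ℝ (baseImage F (testFn q α γ c₃ c₄ c₅ d)) (q.1, q.2.1)).IsInvertible := by
  refine isInvertible_fderiv_baseImage_testFn (h.contDiffAt q hq) ?_
  rw [(h.time_fderiv hq).1, (h.time_fderiv hq).2, h.space_fderiv_u hq]
  simpa using ⟨h.time_fderiv_ne hq, h.space_fderiv_ne hq⟩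

/-- The determining equation which comes from comparing two solution jets, once the new `x` is
known to be affine in `x` and independent of `u`. -/
theorem determining_equation (hq : q ∈ W) {α₁ γ₁ α₂ γ₂ c₃ c₄ C₁ C₃ C₄ C₅ : ℝ}
    (hl₁ : α₁ + q.2.2 ^ n * γ₁ = 0) (hl₂ : α₂ + q.2.2 ^ n * γ₂ + β q.1 * (6 * c₃) = 0)
    (hU : (fun x => (F (q.1, x, testFn q α₂ γ₂ c₃ c₄ 0 0 (q.1, x))).2.2
        - (F (q.1, x, testFn q α₁ γ₁ 0 0 0 0 (q.1, x))).2.2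
        - (C₁ * (x - q.2.1) + C₃ * (x - q.2.1) ^ 3 + C₄ * (x - q.2.1) ^ 4
          + C₅ * (x - q.2.1) ^ 5)) =o[𝓝 q.2.1] fun x => (x - q.2.1) ^ 5) :
    (fderiv ℝ F q (0, 0, 1)).2.2 * (α₂ - α₁)
      - (fderiv ℝ F q (1, 0, 0)).2.1 * (C₁ / (fderiv ℝ F q (0, 1, 0)).2.1)
      + (fderiv ℝ F q (1, 0, 0)).1 * ((F q).2.2 ^ n' * (C₁ / (fderiv ℝ F q (0, 1, 0)).2.1)
        + β' (F q).1 * (6 * (C₃ / (fderiv ℝ F q (0, 1, 0)).2.1 ^ 3))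
        + σ' (F q).1 * (120 * (C₅ / (fderiv ℝ F q (0, 1, 0)).2.1 ^ 5))) = 0 := by
  -- On `t = t₀` the new `x` is affine with slope `a = X_x`, so the Taylor coefficients of `Δ` in
  -- the new `x` are `C_j / a ^ j`. Its time derivative comes from `T_t Δ_t + X_t Δ_x = U_u (α₂ -
  -- α₁)`.
  have hF := h.contDiffAt q hq
  have ha := h.space_fderiv_ne hq
  obtain ⟨Δ, κ, hΔ, -, hκ, -, hder, heq, hpde⟩ := exists_image_difference hF (h.invertible q hq)
    (h.maps q hq) (contDiff_testFn q α₁ γ₁ 0 0 0 0).contDiffAt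
    (contDiff_testFn q α₂ γ₂ c₃ c₄ 0 0).contDiffAt (testFn_self ..) (testFn_self ..)
    (h.isInvertible_fderiv_baseImage hq ..) (h.isInvertible_fderiv_baseImage hq ..)
    (by rw [lhs_testFn]; linear_combination hl₁) (by rw [lhs_testFn]; linear_combination hl₂)
  have hκ' := hκ (h.time_fderiv hq).2 (h.space_fderiv_u hq)
  set a := (fderiv ℝ F q (0, 1, 0)).2.1 with hadef
  have hline : Tendsto (fun x : ℝ => (q.1, x)) (𝓝 q.2.1) (𝓝 (q.1, q.2.1)) :=
    (show ContinuousAt (fun x : ℝ => (q.1, x)) q.2.1 by fun_prop).tendsto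
  have hbase : ∀ α γ c₃ c₄ c₅ d, ∀ᶠ x in 𝓝 q.2.1, baseImage F (testFn q α γ c₃ c₄ c₅ d) (q.1, x)
      = ((F q).1, (F q).2.1 + a * (x - q.2.1)) := by
    intro α γ c₃ c₄ c₅ d
    filter_upwards [h.eventually_testFn_mem hq α γ c₃ c₄ c₅ d] with x hx
    exact Prod.ext (h.time_eq hq hx rfl) (h.space_eq hq hx rfl)
  have hχ : HasDerivAt (fun x => (F q).2.1 + a * (x - q.2.1)) a q.2.1 := by
    simpa using (((hasDerivAt_id q.2.1).sub_const q.2.1).const_mul a).const_add (F q).2.1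
  obtain ⟨e1, e3, e5⟩ := iteratedDeriv_of_isLittleO_quintic (f := fun ξ => Δ ((F q).1, ξ))
    (c₀ := 0) (c₁ := C₁ / a) (c₃ := C₃ / a ^ 3) (c₄ := C₄ / a ^ 4) (c₅ := C₅ / a ^ 5)
    hχ ha (by simp) (contDiffAt_slice hΔ) (by
      refine hU.congr' ?_ EventuallyEq.rfl
      filter_upwards [hline.eventually heq, hbase α₁ γ₁ 0 0 0 0, hbase α₂ γ₂ c₃ c₄ 0 0]
        with x hx h1 h2
      have hx' := hx (h1.trans h2.symm)
      rw [h2] at hx'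
      rw [hx']
      field_simp
      ring)
  have hx0 : fderiv ℝ Δ ((F q).1, (F q).2.1) (0, 1) = C₁ / a := by
    rw [← deriv_snd_slice (hΔ.differentiableAt (by simp)), ← iteratedDeriv_one]
    exact e1
  have ht := hder (1, 0)
  rw [fderiv_testFn, fderiv_baseImage_testFn hF, fderiv_testFn, (h.time_fderiv hq).2,
    h.space_fderiv_u hq] at ht
  simp only [zero_mul, add_zero, mul_one, mul_zero] at ht
  rw [map_pair, hx0] at ht
  rw [e1, e3, e5] at hpde
  rw [← hκ']
  linear_combination (fderiv ℝ F q (1, 0, 0)).1 * hpde - ht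

/-- Mean value theorem in the `u`-direction. The bound on the intermediate value `ρ` is what later
makes it differentiable along a curve. -/
theorem unknown_fderiv_sub (hq : q ∈ W) (hq' : q' ∈ W) (ht : q'.1 = q.1) (hx : q'.2.1 = q.2.1) :
    ∃ ρ : ℝ, |ρ - q.2.2| ≤ |q'.2.2 - q.2.2| ∧ (q.1, q.2.1, ρ) ∈ W ∧
      (F q').2.2 - (F q).2.2 = (fderiv ℝ F (q.1, q.2.1, ρ) (0, 0, 1)).2.2 * (q'.2.2 - q.2.2) := by
  obtain ⟨z, hz, hzz⟩ := domain_mvt (f := fun r => (F r).2.2) (s := W)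
    (fun r hr => (h.differentiableAt hr).snd.snd.hasFDerivAt.hasFDerivWithinAt) h.convex hq hq'
  have hzW := h.convex.segment_subset hq hq' hz
  obtain ⟨θ, hθ, rfl⟩ := (segment_eq_image' ℝ q q').subset hz
  have he : q' - q = (0, 0, q'.2.2 - q.2.2) :=
    Prod.ext (sub_eq_zero.2 ht) (Prod.ext (sub_eq_zero.2 hx) rfl)
  have hz' : q + θ • (q' - q) = (q.1, q.2.1, q.2.2 + θ * (q'.2.2 - q.2.2)) := by
    rw [he]; ext <;> simp
  simp only [hz'] at hzW hzz
  refine ⟨_, ?_, hzW, ?_⟩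
  · rw [add_sub_cancel_left, abs_mul, abs_of_nonneg hθ.1]
    exact mul_le_of_le_one_left (abs_nonneg _) hθ.2
  · rw [fderiv_snd_snd_comp (h.differentiableAt hzW), he, map_triple] at hzz
    simpa [mul_comm] using hzz

theorem differentiableAt_unknown_fderiv (hq : q ∈ W) :
    DifferentiableAt ℝ (fun r => (fderiv ℝ F r (0, 0, 1)).2.2) q := by
  have h1 : ContDiffAt ℝ ∞ (fderiv ℝ F) q := (h.contDiffAt q hq).fderiv_right (by simp)
  have h2 := h1.differentiableAt (by simp)
  exact (h2.clm_apply (differentiableAt_const _)).snd.snd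

/-- The jets differ by `(x - x₀) ^ 4`, which the old equation does not see. In `U` the difference
becomes `U_u (x - x₀) ^ 4`, whose coefficient of order five is the derivative of `U_u` along `(0, 1,
γ)`. The new equation sees it through `σ' ≠ 0`, so it vanishes. -/
theorem fderiv_unknown_fderiv_apply (hq : q ∈ W) (γ : ℝ) :
    fderiv ℝ (fun r => (fderiv ℝ F r (0, 0, 1)).2.2) q (0, 1, γ) = 0 := by
  set V : VarPt → ℝ := fun r => (fderiv ℝ F r (0, 0, 1)).2.2 with hV
  set α := -(q.2.2 ^ n * γ) with hα
  let f₁ : ℝ → ℝ := fun x => testFn q α γ 0 0 0 0 (q.1, x)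
  let f₂ : ℝ → ℝ := fun x => testFn q α γ 0 1 0 0 (q.1, x)
  have hf₁ : ∀ x, f₁ x = q.2.2 + γ * (x - q.2.1) := fun x => by simp [f₁, testFn]
  have hf₂ : ∀ x, f₂ x - f₁ x = (x - q.2.1) ^ 4 := fun x => by simp [f₁, f₂, testFn]
  have hex : ∀ x, ∃ ρ : ℝ, (q.1, x, f₁ x) ∈ W → (q.1, x, f₂ x) ∈ W →
      |ρ - f₁ x| ≤ |f₂ x - f₁ x| ∧ (F (q.1, x, f₂ x)).2.2 - (F (q.1, x, f₁ x)).2.2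
        = V (q.1, x, ρ) * (f₂ x - f₁ x) := by
    intro x
    by_cases hw : (q.1, x, f₁ x) ∈ W ∧ (q.1, x, f₂ x) ∈ W
    · obtain ⟨ρ, h1, -, h2⟩ := h.unknown_fderiv_sub hw.1 hw.2 rfl rfl
      exact ⟨ρ, fun _ _ => ⟨h1, h2⟩⟩
    -- An arbitrary value off `W`, so that `ρ` can be chosen as a function of all real `x`.
    · exact ⟨0, fun h1 h2 => absurd ⟨h1, h2⟩ hw⟩
  choose ρ hρ using hex
  have hev : ∀ᶠ x in 𝓝 q.2.1, |ρ x - f₁ x| ≤ |f₂ x - f₁ x| ∧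
      (F (q.1, x, f₂ x)).2.2 - (F (q.1, x, f₁ x)).2.2 = V (q.1, x, ρ x) * (f₂ x - f₁ x) := by
    filter_upwards [h.eventually_testFn_mem hq α γ 0 0 0 0,
      h.eventually_testFn_mem hq α γ 0 1 0 0] with x h1 h2
    exact hρ x h1 h2
  have hρ0 : ρ q.2.1 = q.2.2 := by
    have := hev.self_of_nhds.1
    rw [hf₂, hf₁] at this
    simpa [sub_eq_zero] using this
  have hlin : (fun x => (x - q.2.1) ^ 4) =o[𝓝 q.2.1] fun x => x - q.2.1 :=
    IsLittleO.of_norm_left (by simpa using isLittleO_pow_sub_sub q.2.1 (m := 4) (by norm_num))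
  -- `ρ` differs from the affine function `f₁` by at most `(x - x₀) ^ 4`, hence has the same
  -- derivative at `x₀`.
  have hρd : HasDerivAt ρ γ q.2.1 := by
    rw [hasDerivAt_iff_isLittleO]
    refine (IsBigO.of_bound 1 ?_).trans_isLittleO hlin
    filter_upwards [hev] with x hx
    have := hx.1
    rw [hf₂, hf₁] at this
    rw [hρ0, smul_eq_mul, one_mul, Real.norm_eq_abs, Real.norm_eq_abs]
    convert this using 2
    ring
  have hcurve : HasDerivAt (fun x => ((q.1, x, ρ x) : VarPt)) ((0, 1, γ) : VarPt) q.2.1 :=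
    (hasDerivAt_const _ _).prodMk ((hasDerivAt_id _).prodMk hρd)
  have hVd : HasDerivAt (fun x => V (q.1, x, ρ x)) (fderiv ℝ V q (0, 1, γ)) q.2.1 := by
    refine HasFDerivAt.comp_hasDerivAt (f := fun x => ((q.1, x, ρ x) : VarPt)) (l := V) _ ?_ hcurve
    rw [hρ0]
    exact (h.differentiableAt_unknown_fderiv hq).hasFDerivAt
  set C₅ := fderiv ℝ V q (0, 1, γ) with hC
  have hVo := hasDerivAt_iff_isLittleO.1 hVd
  rw [hρ0] at hVo
  have hprod := hVo.mul_isBigO (isBigO_refl (fun x => (x - q.2.1) ^ 4) (𝓝 q.2.1))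
  have hdet := h.determining_equation hq (α₁ := α) (γ₁ := γ) (α₂ := α) (γ₂ := γ) (c₃ := 0)
    (c₄ := 1) (C₁ := 0) (C₃ := 0) (C₄ := V q) (C₅ := C₅) (by rw [hα]; ring) (by rw [hα]; ring) (by
      refine hprod.congr' ?_ (Eventually.of_forall fun x => by ring)
      filter_upwards [hev] with x hx
      change _ = (F (q.1, x, f₂ x)).2.2 - (F (q.1, x, f₁ x)).2.2 - _
      rw [hx.2, hf₂, smul_eq_mul]
      ring)
  have h5 := pow_ne_zero 5 (h.space_fderiv_ne hq)
  simp only [sub_self, mul_zero, zero_div, zero_add, add_zero] at hdet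
  have h6 := (mul_eq_zero.1 hdet).resolve_left (h.time_fderiv_ne hq)
  have h7 := (mul_eq_zero.1 h6).resolve_left (h.new_sigma_ne_zero q hq)
  simpa [h.space_fderiv_ne hq] using h7

theorem unknown_fderiv_eq (hq : q ∈ W) (hq' : q' ∈ W) (ht : q'.1 = q.1) :
    (fderiv ℝ F q' (0, 0, 1)).2.2 = (fderiv ℝ F q (0, 0, 1)).2.2 := by
  refine eq_of_fderiv_eq_zero_along (G := fun r => (fderiv ℝ F r (0, 0, 1)).2.2) h.convex
    (fun r hr => h.differentiableAt_unknown_fderiv hr) hq hq' fun r hr => ?_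
  have h0 := h.fderiv_unknown_fderiv_apply hr 0
  have h1 := h.fderiv_unknown_fderiv_apply hr 1
  set L := fderiv ℝ (fun r => (fderiv ℝ F r (0, 0, 1)).2.2) r
  have he : q' - q = ((q' - q).2.1 - (q' - q).2.2) • ((0, 1, 0) : VarPt)
      + (q' - q).2.2 • ((0, 1, 1) : VarPt) := by
    refine Prod.ext ?_ (Prod.ext ?_ ?_)
    · simp [ht]
    · simp
    · simp
  rw [he, map_add, map_smul, map_smul, h0, h1]
  simp

theorem unknown_sub (hq : q ∈ W) (hq' : q' ∈ W) (ht : q'.1 = q.1) (hx : q'.2.1 = q.2.1) :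
    (F q').2.2 = (F q).2.2 + (fderiv ℝ F q (0, 0, 1)).2.2 * (q'.2.2 - q.2.2) := by
  obtain ⟨ρ, -, hρ, he⟩ := h.unknown_fderiv_sub hq hq' ht hx
  rw [h.unknown_fderiv_eq hq hρ rfl] at he
  linear_combination he

theorem eventually_unknown_testFn_sub (hq : q ∈ W) (α₁ γ₁ α₂ γ₂ c₃ : ℝ) :
    ∀ᶠ x in 𝓝 q.2.1, (F (q.1, x, testFn q α₂ γ₂ c₃ 0 0 0 (q.1, x))).2.2
        - (F (q.1, x, testFn q α₁ γ₁ 0 0 0 0 (q.1, x))).2.2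
      = (fderiv ℝ F q (0, 0, 1)).2.2 * ((γ₂ - γ₁) * (x - q.2.1) + c₃ * (x - q.2.1) ^ 3) := by
  filter_upwards [h.eventually_testFn_mem hq α₁ γ₁ 0 0 0 0,
    h.eventually_testFn_mem hq α₂ γ₂ c₃ 0 0 0] with x h1 h2
  rw [h.unknown_sub h1 h2 rfl rfl, h.unknown_fderiv_eq hq h1 rfl]
  simp only [testFn]
  ring

/-- The jets differ by `(x - x₀) ^ 3`, compensated by `-6 β` in `u_t`. Since `U` is affine in `u`
with factor constant on `t = t₀`, no fifth-order term appears. -/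
theorem beta_eq (hq : q ∈ W) :
    β' (F q).1 * (fderiv ℝ F q (1, 0, 0)).1 = β q.1 * (fderiv ℝ F q (0, 1, 0)).2.1 ^ 3 := by
  have hdet := h.determining_equation hq (α₁ := 0) (γ₁ := 0) (α₂ := -(6 * β q.1)) (γ₂ := 0)
    (c₃ := 1) (c₄ := 0) (C₁ := 0) (C₃ := (fderiv ℝ F q (0, 0, 1)).2.2) (C₄ := 0) (C₅ := 0)
    (by ring) (by ring) (by
      refine (isLittleO_zero _ _).congr' ?_ EventuallyEq.rfl
      filter_upwards [h.eventually_unknown_testFn_sub hq 0 0 (-(6 * β q.1)) 0 1] with x hx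
      rw [hx]
      ring)
  have ha := h.space_fderiv_ne hq
  have hA := h.unknown_fderiv_ne hq
  set a := (fderiv ℝ F q (0, 1, 0)).2.1
  set A := (fderiv ℝ F q (0, 0, 1)).2.2
  have hz : 6 * A * (β' (F q).1 * (fderiv ℝ F q (1, 0, 0)).1 / a ^ 3 - β q.1) = 0 := by
    linear_combination hdet
  have hz' := (mul_eq_zero.1 hz).resolve_left (mul_ne_zero (by norm_num) hA)
  field_simp at hz'
  linarith

/-- The jets differ by a unit of slope, compensated by `-u ^ n` in `u_t`. -/
theorem power_eq (hq : q ∈ W) :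
    (fderiv ℝ F q (1, 0, 0)).1 * (F q).2.2 ^ n'
      = (fderiv ℝ F q (0, 1, 0)).2.1 * q.2.2 ^ n + (fderiv ℝ F q (1, 0, 0)).2.1 := by
  have hdet := h.determining_equation hq (α₁ := 0) (γ₁ := 0) (α₂ := -(q.2.2 ^ n)) (γ₂ := 1)
    (c₃ := 0) (c₄ := 0) (C₁ := (fderiv ℝ F q (0, 0, 1)).2.2) (C₃ := 0) (C₄ := 0) (C₅ := 0)
    (by ring) (by ring) (by
      refine (isLittleO_zero _ _).congr' ?_ EventuallyEq.rfl
      filter_upwards [h.eventually_unknown_testFn_sub hq 0 0 (-(q.2.2 ^ n)) 1 0] with x hx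
      rw [hx]
      ring)
  have ha := h.space_fderiv_ne hq
  have hA := h.unknown_fderiv_ne hq
  simp only [sub_zero, mul_zero, zero_div, add_zero] at hdet
  field_simp at hdet
  refine mul_left_cancel₀ hA ?_
  linarith

theorem space_time_fderiv_eq (hq : q ∈ W) (hq' : q' ∈ W) (ht : q'.1 = q.1) (hx : q'.2.1 = q.2.1) :
    (fderiv ℝ F q' (1, 0, 0)).2.1 = (fderiv ℝ F q (1, 0, 0)).2.1 := by
  rw [← fderiv_snd_fst_comp (h.differentiableAt hq), ← fderiv_snd_fst_comp (h.differentiableAt hq')]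
  refine fderiv_apply_eq_of_eventuallyEq (h.differentiableAt hq').snd.fst
    (h.differentiableAt hq).snd.fst ?_
  filter_upwards [eventually_add_smul_mem h.isOpen hq' (1, 0, 0),
    eventually_add_smul_mem h.isOpen hq (1, 0, 0)] with s h1 h2
  have := h.space_eq h2 h1 (by simp [ht])
  simpa [hx] using this

/-- For exponents other than `0` and `1`, the dependence on `u` is rigid. -/
theorem rigidity (hn : n ≠ 0) (hn1 : n ≠ 1) (hn' : n' ≠ 0) (hq : q ∈ W) :
    n' = n ∧ (F q).2.2 = (fderiv ℝ F q (0, 0, 1)).2.2 * q.2.2 ∧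
      (fderiv ℝ F q (1, 0, 0)).2.1 = 0 ∧
      (fderiv ℝ F q (1, 0, 0)).1 * (fderiv ℝ F q (0, 0, 1)).2.2 ^ n
        = (fderiv ℝ F q (0, 1, 0)).2.1 := by
  have hmem : ∀ᶠ v in 𝓝 q.2.2, ((q.1, q.2.1, v) : VarPt) ∈ W :=
    (show ContinuousAt (fun v : ℝ => ((q.1, q.2.1, v) : VarPt)) q.2.2 by fun_prop).eventually_mem
      (h.isOpen.mem_nhds hq)
  set A := (fderiv ℝ F q (0, 0, 1)).2.2 with hA
  -- With `t` and `x` frozen, `power_eq` is an identity in `u` alone: `T_t`, `X_x`, `X_t` are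
  -- constant there, and the new unknown is affine in `u`.
  obtain ⟨h1, h2, h3, h4⟩ := zpow_affine_rigidity hn hn1 hn' (h.unknown_fderiv_ne hq)
    (h.space_fderiv_ne hq) (u := q.2.2) (B := (F q).2.2 - A * q.2.2)
    (c := (fderiv ℝ F q (1, 0, 0)).2.1) (τ := (fderiv ℝ F q (1, 0, 0)).1) (by
      filter_upwards [hmem] with v hv
      have := h.power_eq hv
      rw [h.time_fderiv_eq hq hv rfl, h.space_fderiv_eq hq hv rfl,
        h.space_time_fderiv_eq hq hv rfl rfl, h.unknown_sub hq hv rfl rfl] at this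
      rw [← this, ← hA]
      congr 2
      simp only
      ring)
  exact ⟨h1, by linarith, h3, h4⟩

theorem unknown_fderiv_x (hn : n ≠ 0) (hn1 : n ≠ 1) (hn' : n' ≠ 0) (hq : q ∈ W) :
    (fderiv ℝ F q (0, 1, 0)).2.2 = 0 := by
  have h1 : HasDerivAt (fun s : ℝ => (F (q + s • ((0, 1, 0) : VarPt))).2.2)
      (fderiv ℝ (fun r => (F r).2.2) q (0, 1, 0)) 0 :=
    (h.differentiableAt hq).snd.snd.hasFDerivAt.hasLineDerivAt _
  rw [← fderiv_snd_snd_comp (h.differentiableAt hq)]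
  refine (h1.congr_of_eventuallyEq (f₁ := fun _ => (F q).2.2) ?_).unique (hasDerivAt_const _ _)
  filter_upwards [eventually_add_smul_mem h.isOpen hq (0, 1, 0)] with s hs
  rw [(h.rigidity hn hn1 hn' hs).2.1, (h.rigidity hn hn1 hn' hq).2.1,
    h.unknown_fderiv_eq hq hs (by simp)]
  simp

/-- A constant `f` is a solution. By `rigidity` its image `g` is constant in the new `x` at the
image time, so the new equation gives `g_t = 0` at the image point, and the chain rule turns this
into `U_t = 0`. -/
theorem unknown_fderiv_t (hn : n ≠ 0) (hn1 : n ≠ 1) (hn' : n' ≠ 0) (hq : q ∈ W) :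
    (fderiv ℝ F q (1, 0, 0)).2.2 = 0 := by
  have hF := h.contDiffAt q hq
  set f := testFn q 0 0 0 0 0 0 with hf
  have hfc : ContDiffAt ℝ ∞ f (q.1, q.2.1) := (contDiff_testFn ..).contDiffAt
  have hfq : f (q.1, q.2.1) = q.2.2 := testFn_self ..
  have hP := h.isInvertible_fderiv_baseImage hq 0 0 0 0 0 0
  obtain ⟨g, hg, he⟩ := exists_image hF hfc hfq hP
  have hlg := (h.maps q hq f g hfc hfq hP hg he).1 (by rw [lhs_testFn]; ring)
  set a := (fderiv ℝ F q (0, 1, 0)).2.1 with hadef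
  have hχ : HasDerivAt (fun x => (F q).2.1 + a * (x - q.2.1)) a q.2.1 := by
    simpa using (((hasDerivAt_id q.2.1).sub_const q.2.1).const_mul a).const_add (F q).2.1
  have hline : Tendsto (fun x : ℝ => (q.1, x)) (𝓝 q.2.1) (𝓝 (q.1, q.2.1)) :=
    (show ContinuousAt (fun x : ℝ => (q.1, x)) q.2.1 by fun_prop).tendsto
  obtain ⟨e1, e3, e5⟩ := iteratedDeriv_of_isLittleO_quintic (f := fun ξ => g ((F q).1, ξ))
    (c₀ := (F q).2.2) (c₁ := 0) (c₃ := 0) (c₄ := 0) (c₅ := 0)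
    hχ (h.space_fderiv_ne hq) (by simp) (contDiffAt_slice hg) (by
      refine (isLittleO_zero _ _).congr' ?_ EventuallyEq.rfl
      filter_upwards [hline.eventually he, h.eventually_testFn_mem hq 0 0 0 0 0 0] with x hx hW
      have hb : baseImage F f (q.1, x) = ((F q).1, (F q).2.1 + a * (x - q.2.1)) :=
        Prod.ext (h.time_eq hq hW rfl) (h.space_eq hq hW rfl)
      rw [hb] at hx
      rw [hx, (h.rigidity hn hn1 hn' hW).2.1, (h.rigidity hn hn1 hn' hq).2.1,
        h.unknown_fderiv_eq hq hW rfl]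
      simp [testFn])
  have hgd := hg.differentiableAt (by simp)
  rw [iteratedDeriv_one] at e1
  rw [lhs, deriv_fst_slice hgd, e1, e3, e5] at hlg
  simp only [mul_zero, add_zero] at hlg
  have hb : HasFDerivAt (baseImage F f) (fderiv ℝ (baseImage F f) (q.1, q.2.1)) (q.1, q.2.1) :=
    ((contDiffAt_baseImage hF hfc hfq).differentiableAt (by simp)).hasFDerivAt
  have hgd' : HasFDerivAt g (fderiv ℝ g ((F q).1, (F q).2.1)) (baseImage F f (q.1, q.2.1)) := by
    rw [baseImage_self hfq]; exact hgd.hasFDerivAt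
  have h1 := (hgd'.comp (q.1, q.2.1) hb).congr_of_eventuallyEq (he.mono fun z hz => hz.symm)
  have h2 := (hasFDerivAt_comp_graph (hF.differentiableAt (by simp)) hfc hfq).snd.snd
  have h3 := DFunLike.congr_fun (h1.unique h2) (1, 0)
  simp only [ContinuousLinearMap.comp_apply, ContinuousLinearMap.prod_apply,
    ContinuousLinearMap.coe_fst', ContinuousLinearMap.coe_snd'] at h3
  rw [hf, fderiv_baseImage_testFn hF, fderiv_testFn, map_pair, hlg,
    (h.rigidity hn hn1 hn' hq).2.2.1, h.space_fderiv_u hq] at h3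
  simpa using h3.symm

end MapsEquationOn
end Rigidity
-- Independence of the arbitrary elements, and constancy of the factors.
section ArbitraryElements

variable {n : ℤ} {Ω : Set ExtPt} {Φ : Transf}

theorem hasDerivAt_mul_exp (b k t₀ t : ℝ) :
    HasDerivAt (fun s => b * Real.exp (k * (s - t₀))) (k * (b * Real.exp (k * (t - t₀)))) t := by
  have h := ((((hasDerivAt_id t).sub_const t₀).const_mul k).exp).const_mul b
  refine h.congr_deriv ?_
  simp only [id]
  ring

/-- These coefficients take prescribed nonzero values `b`, `s` at `t₀`, have arbitrary derivatives
`k b`, `l s` there, and vanish nowhere, so they are admissible on all of `ℝ`. -/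
theorem inClass_exp (hn : n ≠ 0) {b s : ℝ} (hb : b ≠ 0) (hs : s ≠ 0) (k l t₀ : ℝ) :
    InClass n Set.univ (fun t => b * Real.exp (k * (t - t₀)))
      (fun t => s * Real.exp (l * (t - t₀))) where
  exponent_ne_zero := hn
  isOpen := isOpen_univ
  ordConnected := Set.ordConnected_univ
  smooth_beta := by fun_prop
  smooth_sigma := by fun_prop
  beta_ne_zero := fun _ _ => mul_ne_zero hb (Real.exp_ne_zero _)
  sigma_ne_zero := fun _ _ => mul_ne_zero hs (Real.exp_ne_zero _)

theorem hasFDerivAt_lift {β σ : ℝ → ℝ} {q : VarPt} {β₁ σ₁ : ℝ} (hβ : HasDerivAt β β₁ q.1)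
    (hσ : HasDerivAt σ σ₁ q.1) :
    ∃ L : VarPt →L[ℝ] ExtPt, HasFDerivAt (lift β σ) L q ∧
      ∀ v, L v = (v.1, v.2.1, v.2.2, β₁ * v.1, σ₁ * v.1) := by
  have h1 : HasFDerivAt (fun r : VarPt => r.1) (ContinuousLinearMap.fst ℝ ℝ (ℝ × ℝ)) q :=
    hasFDerivAt_fst
  have h2 : HasFDerivAt (fun r : VarPt => r.2) (ContinuousLinearMap.snd ℝ ℝ (ℝ × ℝ)) q :=
    hasFDerivAt_snd
  have hb := hβ.hasFDerivAt.comp q h1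
  have hs := hσ.hasFDerivAt.comp q h1
  refine ⟨_, h1.prodMk (h2.fst.prodMk (h2.snd.prodMk (hb.prodMk hs))), fun v => ?_⟩
  simp [mul_comm]

theorem fderiv_induced {β σ : ℝ → ℝ} {q : VarPt} {β₁ σ₁ : ℝ} (hβ : HasDerivAt β β₁ q.1)
    (hσ : HasDerivAt σ σ₁ q.1) (hΦ : DifferentiableAt ℝ Φ.toMap (lift β σ q)) (v : VarPt) :
    fderiv ℝ (Φ.induced β σ) q v =
      ((fderiv ℝ Φ.toMap (lift β σ q) (v.1, v.2.1, v.2.2, β₁ * v.1, σ₁ * v.1)).1,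
      (fderiv ℝ Φ.toMap (lift β σ q) (v.1, v.2.1, v.2.2, β₁ * v.1, σ₁ * v.1)).2.1,
      (fderiv ℝ Φ.toMap (lift β σ q) (v.1, v.2.1, v.2.2, β₁ * v.1, σ₁ * v.1)).2.2.1) := by
  obtain ⟨L, hL, hLv⟩ := hasFDerivAt_lift hβ hσ
  have h := hΦ.hasFDerivAt.comp q hL
  have h' : HasFDerivAt (Φ.induced β σ) _ q := h.fst.prodMk (h.snd.fst.prodMk h.snd.snd.fst)
  rw [h'.fderiv, ← hLv v]
  rfl

theorem contDiffAt_induced {β σ : ℝ → ℝ} {q : VarPt} (hβ : ContDiffAt ℝ ∞ β q.1)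
    (hσ : ContDiffAt ℝ ∞ σ q.1) (hΦ : ContDiffAt ℝ ∞ Φ.toMap (lift β σ q)) :
    ContDiffAt ℝ ∞ (Φ.induced β σ) q := by
  have h1 : ContDiffAt ℝ ∞ (fun r : VarPt => r.1) q := contDiffAt_fst
  have hlift : ContDiffAt ℝ ∞ (lift β σ) q :=
    h1.prodMk (contDiffAt_snd.fst.prodMk (contDiffAt_snd.snd.prodMk
      ((hβ.comp q h1).prodMk (hσ.comp q h1))))
  have h := hΦ.comp q hlift
  exact h.fst.prodMk (h.snd.fst.prodMk h.snd.snd.fst)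

/-- `W` is a ball whose lift by the chosen coefficients stays in `Ω`. Its convexity supports the
mean value arguments on time slices. -/
theorem exists_mapsEquationOn (hn : n ≠ 0) (hΩ : IsOpen Ω) (hv : Ω ⊆ validPts n)
    (hΦ : IsGeneralizedEquiv n Ω Φ) {t x u b s : ℝ} (hp : (t, x, u, b, s) ∈ Ω) (k l : ℝ) :
    ∃ (W : Set VarPt) (n' : ℤ) (β' σ' : ℝ → ℝ), (t, x, u) ∈ W ∧ n' ≠ 0 ∧
      MapsEquationOn (Φ.induced (fun τ => b * Real.exp (k * (τ - t)))
        (fun τ => s * Real.exp (l * (τ - t)))) W n n' (fun τ => b * Real.exp (k * (τ - t)))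
        (fun τ => s * Real.exp (l * (τ - t))) β' σ' ∧
      (∀ q ∈ W, lift (fun τ => b * Real.exp (k * (τ - t)))
        (fun τ => s * Real.exp (l * (τ - t))) q ∈ Ω) ∧
      Φ.N (t, x, u, b, s) = n' ∧ Φ.B (t, x, u, b, s) = β' (Φ.T (t, x, u, b, s)) ∧
      Φ.S (t, x, u, b, s) = σ' (Φ.T (t, x, u, b, s)) := by
  set β : ℝ → ℝ := fun τ => b * Real.exp (k * (τ - t)) with hβ
  set σ : ℝ → ℝ := fun τ => s * Real.exp (l * (τ - t)) with hσ
  obtain ⟨hb, hs, -⟩ := hv hp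
  have hcl := inClass_exp hn hb hs k l t
  obtain ⟨n', J', β', σ', hcl', hq⟩ := hΦ.2.2 _ _ _ hcl
  have h0 : lift β σ (t, x, u) = (t, x, u, b, s) := by simp [lift, hβ, hσ]
  have hβs : ContDiff ℝ ∞ β := by fun_prop
  have hσs : ContDiff ℝ ∞ σ := by fun_prop
  have hcont : Continuous (lift β σ) := by
    have := hβs.continuous
    have := hσs.continuous
    unfold lift
    fun_prop
  have hopen : IsOpen (lift β σ ⁻¹' Ω) := hΩ.preimage hcont
  obtain ⟨r, hr, hball⟩ := Metric.isOpen_iff.1 hopen (t, x, u) (by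
    rw [Set.mem_preimage, h0]; exact hp)
  have hmem := hq (t, x, u) (Set.mem_univ _) (by rw [h0]; exact hp)
  rw [h0] at hmem
  refine ⟨Metric.ball (t, x, u) r, n', β', σ', Metric.mem_ball_self hr, hcl'.exponent_ne_zero,
    ⟨Metric.isOpen_ball, convex_ball _ _, fun q hqW => ?_, fun q hqW => ?_, fun q hqW => ?_,
      fun q hqW => ?_, fun q hqW => ?_⟩, fun q hqW => hball hqW, hmem.2.2.2.1, hmem.2.2.2.2.1,
      hmem.2.2.2.2.2.1⟩
  · exact contDiffAt_induced hβs.contDiffAt hσs.contDiffAt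
      (hΦ.1.contDiffAt (hΩ.mem_nhds (hball hqW)))
  · exact (hq q (Set.mem_univ _) (hball hqW)).1
  · exact hcl.sigma_ne_zero _ (Set.mem_univ _)
  · exact hcl'.sigma_ne_zero _ (hq q (Set.mem_univ _) (hball hqW)).2.1
  · exact (hq q (Set.mem_univ _) (hball hqW)).2.2.2.2.2.2

theorem map_quintuple (L : ExtPt →L[ℝ] ExtPt) (v : ExtPt) :
    L v = v.1 • L (1, 0, 0, 0, 0) + v.2.1 • L (0, 1, 0, 0, 0) + v.2.2.1 • L (0, 0, 1, 0, 0)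
      + v.2.2.2.1 • L (0, 0, 0, 1, 0) + v.2.2.2.2 • L (0, 0, 0, 0, 1) := by
  simp only [← map_smul, ← map_add]
  simp

theorem map_time_direction (L : ExtPt →L[ℝ] ExtPt) (c d : ℝ) :
    L (1, 0, 0, c, d) = L (1, 0, 0, 0, 0) + c • L (0, 0, 0, 1, 0) + d • L (0, 0, 0, 0, 1) := by
  rw [map_quintuple]
  simp

/-- The first-order form of a generalized equivalence transformation. -/
theorem IsGeneralizedEquiv.gradient_form (hn : n ≠ 0) (hn1 : n ≠ 1) (hΩ : IsOpen Ω)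
    (hv : Ω ⊆ validPts n) (hΦ : IsGeneralizedEquiv n Ω Φ) {t x u b s : ℝ}
    (hp : (t, x, u, b, s) ∈ Ω) :
    ∃ τ a A : ℝ, a ≠ 0 ∧ A ≠ 0 ∧
      (∀ v, (fderiv ℝ Φ.toMap (t, x, u, b, s) v).1 = τ * v.1 ∧
        (fderiv ℝ Φ.toMap (t, x, u, b, s) v).2.1 = a * v.2.1 ∧
        (fderiv ℝ Φ.toMap (t, x, u, b, s) v).2.2.1 = A * v.2.2.1) ∧
      Φ.U (t, x, u, b, s) = A * u ∧ τ * A ^ n = a ∧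
      Φ.B (t, x, u, b, s) * τ = b * a ^ 3 ∧ Φ.S (t, x, u, b, s) * τ = s * a ^ 5 ∧
      Φ.N (t, x, u, b, s) = n ∧
      (∀ᶠ h : ℝ in 𝓝 0, (fderiv ℝ Φ.toMap ((t, x, u, b, s) + h • ((0, 1, 0, 0, 0) : ExtPt))
        (0, 1, 0, 0, 0)).2.1 = a) ∧
      (∀ᶠ h : ℝ in 𝓝 0, (fderiv ℝ Φ.toMap ((t, x, u, b, s) + h • ((0, 0, 1, 0, 0) : ExtPt))
        (0, 0, 1, 0, 0)).2.2.1 = A) := by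
  obtain ⟨hb, hs, -⟩ := hv hp
  have hd : ∀ p ∈ Ω, DifferentiableAt ℝ Φ.toMap p := fun p hp' =>
    (hΦ.1.contDiffAt (hΩ.mem_nhds hp')).differentiableAt (by simp)
  set M := fderiv ℝ Φ.toMap (t, x, u, b, s) with hM
  have hlift : ∀ k l : ℝ, lift (fun τ => b * Real.exp (k * (τ - t)))
      (fun τ => s * Real.exp (l * (τ - t))) (t, x, u) = (t, x, u, b, s) := by
    intro k l; simp [lift]
  have hder : ∀ k l : ℝ, ∀ v : VarPt,
      fderiv ℝ (Φ.induced (fun τ => b * Real.exp (k * (τ - t)))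
        (fun τ => s * Real.exp (l * (τ - t)))) (t, x, u) v
      = ((M (v.1, v.2.1, v.2.2, k * b * v.1, l * s * v.1)).1,
        (M (v.1, v.2.1, v.2.2, k * b * v.1, l * s * v.1)).2.1,
        (M (v.1, v.2.1, v.2.2, k * b * v.1, l * s * v.1)).2.2.1) := by
    intro k l v
    rw [fderiv_induced (hasDerivAt_mul_exp b k t _) (hasDerivAt_mul_exp s l t _)
      (by rw [hlift]; exact hd _ hp), hlift]
    simp [hM]
  -- The time derivative of the induced map is the derivative of `Φ` along `(1, 0, 0, k b, l s)`,
  -- while the other entries of these relations do not involve `k`, `l`. Comparing `(k, l) = (0, 0),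
  -- (1, 0), (0, 1)` and dividing by `b` and `s` removes all derivatives in `β` and `σ`.
  have key : ∀ k l : ℝ,
      (M (1, 0, 0, k * b, l * s)).1 * (M (0, 0, 1, 0, 0)).2.2.1 ^ n = (M (0, 1, 0, 0, 0)).2.1 ∧
      (M (1, 0, 0, k * b, l * s)).2.1 = 0 ∧ (M (1, 0, 0, k * b, l * s)).2.2.1 = 0 := by
    intro k l
    obtain ⟨W, n', β', σ', hqW, hn', hW, -, -⟩ := exists_mapsEquationOn hn hΩ hv hΦ hp k l
    have h1 := (hW.rigidity hn hn1 hn' hqW).2.2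
    have h2 := hW.unknown_fderiv_t hn hn1 hn' hqW
    simp only [hder, mul_one, mul_zero] at h1 h2
    exact ⟨h1.2, h1.1, h2⟩
  obtain ⟨W, n', β', σ', hqW, hn', hW, hWΩ, hN, hB, hS⟩ :=
    exists_mapsEquationOn hn hΩ hv hΦ hp 0 0
  have hT0 := hW.time_fderiv hqW
  have hXu := hW.space_fderiv_u hqW
  have ha := hW.space_fderiv_ne hqW
  have hA := hW.unknown_fderiv_ne hqW
  have hβe := hW.beta_eq hqW
  have hσe := hW.sigma_eq' hqW
  have hUx := hW.unknown_fderiv_x hn hn1 hn' hqW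
  have hrig := hW.rigidity hn hn1 hn' hqW
  have hx_slice : ∀ᶠ h : ℝ in 𝓝 0,
      (fderiv ℝ Φ.toMap ((t, x, u, b, s) + h • ((0, 1, 0, 0, 0) : ExtPt)) (0, 1, 0, 0, 0)).2.1
        = (M (0, 1, 0, 0, 0)).2.1 := by
    filter_upwards [eventually_add_smul_mem hW.isOpen hqW (0, 1, 0)] with h hh
    have he := hW.space_fderiv_eq hqW hh (by simp)
    rw [fderiv_induced (hasDerivAt_mul_exp b 0 t _) (hasDerivAt_mul_exp s 0 t _)
      (hd _ (hWΩ _ hh)), hder] at he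
    simpa [lift] using he
  have hu_slice : ∀ᶠ h : ℝ in 𝓝 0,
      (fderiv ℝ Φ.toMap ((t, x, u, b, s) + h • ((0, 0, 1, 0, 0) : ExtPt)) (0, 0, 1, 0, 0)).2.2.1
        = (M (0, 0, 1, 0, 0)).2.2.1 := by
    filter_upwards [eventually_add_smul_mem hW.isOpen hqW (0, 0, 1)] with h hh
    have he := hW.unknown_fderiv_eq hqW hh (by simp)
    rw [fderiv_induced (hasDerivAt_mul_exp b 0 t _) (hasDerivAt_mul_exp s 0 t _)
      (hd _ (hWΩ _ hh)), hder] at he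
    simpa [lift] using he
  simp only [hder] at hT0 hXu ha hA hβe hσe hUx hrig
  simp only [Transf.induced, hlift] at hβe hσe hrig
  simp only [sub_self, mul_zero, zero_mul, Real.exp_zero, mul_one] at hT0 hXu ha hA hβe hσe hUx hrig
  set a := (M (0, 1, 0, 0, 0)).2.1 with ha'
  set A := (M (0, 0, 1, 0, 0)).2.2.1 with hA'
  have hAn : A ^ n ≠ 0 := zpow_ne_zero _ hA
  have hτ : ∀ k l : ℝ, (M (1, 0, 0, k * b, l * s)).1 = a / A ^ n := fun k l =>
    (eq_div_iff hAn).2 (key k l).1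
  have k00 := key 0 0
  have k10 := key 1 0
  have k01 := key 0 1
  have t00 := hτ 0 0
  have t10 := hτ 1 0
  have t01 := hτ 0 1
  rw [map_time_direction] at k00 k10 k01 t00 t10 t01
  simp only [zero_mul, one_mul, zero_smul, add_zero, Prod.fst_add, Prod.snd_add, Prod.smul_fst,
    Prod.smul_snd, smul_eq_mul] at k00 k10 k01 t00 t10 t01
  have c1 : (M (0, 0, 0, 1, 0)).1 = 0 := by
    refine (mul_eq_zero.1 (?_ : b * _ = 0)).resolve_left hb; linarith
  have c2 : (M (0, 0, 0, 0, 1)).1 = 0 := by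
    refine (mul_eq_zero.1 (?_ : s * _ = 0)).resolve_left hs; linarith
  have c3 : (M (0, 0, 0, 1, 0)).2.1 = 0 := by
    refine (mul_eq_zero.1 (?_ : b * _ = 0)).resolve_left hb; linarith [k00.2.1, k10.2.1]
  have c4 : (M (0, 0, 0, 0, 1)).2.1 = 0 := by
    refine (mul_eq_zero.1 (?_ : s * _ = 0)).resolve_left hs; linarith [k00.2.1, k01.2.1]
  have c5 : (M (0, 0, 0, 1, 0)).2.2.1 = 0 := by
    refine (mul_eq_zero.1 (?_ : b * _ = 0)).resolve_left hb; linarith [k00.2.2, k10.2.2]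
  have c6 : (M (0, 0, 0, 0, 1)).2.2.1 = 0 := by
    refine (mul_eq_zero.1 (?_ : s * _ = 0)).resolve_left hs; linarith [k00.2.2, k01.2.2]
  refine ⟨(M (1, 0, 0, 0, 0)).1, a, A, ha, hA, fun v => ?_, hrig.2.1, hrig.2.2.2, ?_, ?_,
    hN.trans hrig.1, hx_slice, hu_slice⟩
  · rw [map_quintuple]
    simp only [Prod.fst_add, Prod.snd_add, Prod.smul_fst, Prod.smul_snd, smul_eq_mul, c1, c2, c3,
      c4, c5, c6, hT0.1, hT0.2, hXu, hUx, k00.2.1, k00.2.2]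
    refine ⟨by ring, by ring, by ring⟩
  · rw [hB]; exact hβe
  · rw [hS]; exact hσe

theorem exists_eq_mul_add_const_of_fderiv {E : Type*} [NormedAddCommGroup E] [NormedSpace ℝ E]
    {G : E → ℝ} {s : Set E} (hs : IsOpen s) (hs' : IsPreconnected s)
    (hG : ∀ p ∈ s, DifferentiableAt ℝ G p) (ℓ : E →L[ℝ] ℝ) {δ : ℝ}
    (h : ∀ p ∈ s, ∀ v, fderiv ℝ G p v = δ * ℓ v) : ∃ c, ∀ p ∈ s, G p = δ * ℓ p + c := by
  obtain ⟨c, hc⟩ := hs.exists_eq_add_of_fderiv_eq hs' (f := G) (g := fun p => δ * ℓ p)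
    (fun p hp => (hG p hp).differentiableWithinAt) (by fun_prop) (fun p hp => by
      ext v
      rw [h p hp, (ℓ.hasFDerivAt.const_mul δ).fderiv]
      simp)
  exact ⟨c, hc⟩

/-- If the gradient of a smooth function on a connected open set is proportional to a fixed
covector `ℓ`, and the factor is locally constant along a direction transversal to the kernel of
`ℓ`, then the factor is constant. -/
theorem exists_fderiv_apply_eq_const {E : Type*} [NormedAddCommGroup E] [NormedSpace ℝ E]
    {G : E → ℝ} {s : Set E} (hs : IsOpen s) (hs' : IsPreconnected s) (hG : ContDiffOn ℝ ∞ G s)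
    (ℓ : E →L[ℝ] ℝ) {e : E} (he : ℓ e = 1)
    (h : ∀ p ∈ s, ∀ v, fderiv ℝ G p v = fderiv ℝ G p e * ℓ v)
    (hslice : ∀ p ∈ s, ∀ᶠ r : ℝ in 𝓝 0, fderiv ℝ G (p + r • e) e = fderiv ℝ G p e) :
    ∃ δ, ∀ p ∈ s, fderiv ℝ G p e = δ := by
  have hGs : ∀ p ∈ s, ContDiffAt ℝ ∞ G p := fun p hp => hG.contDiffAt (hs.mem_nhds hp)
  have hd : ∀ p ∈ s, DifferentiableAt ℝ (fderiv ℝ G) p := fun p hp =>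
    ((hGs p hp).fderiv_right (m := ∞) (by simp)).differentiableAt (by simp)
  have happ : ∀ p ∈ s, ∀ w v, fderiv ℝ (fun r => fderiv ℝ G r w) p v
      = fderiv ℝ (fderiv ℝ G) p v w := by
    intro p hp w v
    have := (hd p hp).hasFDerivAt.clm_apply (hasFDerivAt_const w p)
    rw [this.fderiv]
    simp
  refine hs.exists_is_const_of_fderiv_eq_zero hs' (f := fun r => fderiv ℝ G r e)
    (fun p hp => ((hd p hp).clm_apply (differentiableAt_const e)).differentiableWithinAt)
    fun p hp => ?_
  have hde : DifferentiableAt ℝ (fun r => fderiv ℝ G r e) p :=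
    (hd p hp).clm_apply (differentiableAt_const e)
  have h1 : fderiv ℝ (fun r => fderiv ℝ G r e) p e = 0 := by
    have h2 : HasDerivAt (fun r : ℝ => fderiv ℝ G (p + r • e) e)
      (fderiv ℝ (fun r => fderiv ℝ G r e) p e) 0 := hde.hasFDerivAt.hasLineDerivAt e
    exact (h2.congr_of_eventuallyEq (f₁ := fun _ => fderiv ℝ G p e)
      ((hslice p hp).mono fun r hr => hr.symm)).unique (hasDerivAt_const _ _)
  -- Symmetry of the second derivative: for `w` in the kernel of `ℓ`, the derivative of `dG(e)`
  -- along `w` is that of `dG(w)` along `e`, and `dG(w)` vanishes on `s`. Together with `h1` this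
  -- covers all directions, since `v - ℓ v • e` lies in the kernel.
  ext v
  have hker : fderiv ℝ (fun r => fderiv ℝ G r e) p (v - ℓ v • e) = 0 := by
    rw [happ p hp, ((hGs p hp).isSymmSndFDerivAt (by
      rw [minSmoothness_of_isRCLikeNormedField]; exact WithTop.coe_le_coe.2 le_top)) (v - ℓ v • e) e, ← happ p hp]
    have hz : (fun r => fderiv ℝ G r (v - ℓ v • e)) =ᶠ[𝓝 p] fun _ => 0 := by
      filter_upwards [hs.mem_nhds hp] with r hr
      rw [h r hr]
      simp [he]
    rw [hz.fderiv_eq]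
    simp
  rw [map_sub, map_smul, h1, smul_zero, sub_zero] at hker
  simpa using hker

theorem IsGeneralizedEquiv.exists_hasForm (hn : n ≠ 0) (hn1 : n ≠ 1) (hΩ : IsOpen Ω)
    (hc : IsConnected Ω) (hv : Ω ⊆ validPts n) (hΦ : IsGeneralizedEquiv n Ω Φ) :
    ∃ δ₀ δ₁ δ₂ δ₃ : ℝ, δ₁ * δ₃ ≠ 0 ∧ HasForm n δ₀ δ₁ δ₂ δ₃ Ω Φ := by
  have hg := fun (p : ExtPt) (hp : p ∈ Ω) => hΦ.gradient_form hn hn1 hΩ hv (t := p.1) (x := p.2.1)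
    (u := p.2.2.1) (b := p.2.2.2.1) (s := p.2.2.2.2) hp
  have hd : ∀ p ∈ Ω, HasFDerivAt Φ.toMap (fderiv ℝ Φ.toMap p) p := fun p hp =>
    ((hΦ.1.contDiffAt (hΩ.mem_nhds hp)).differentiableAt (by simp)).hasFDerivAt
  have hdT : ∀ p ∈ Ω, ∀ v, fderiv ℝ Φ.T p v = (fderiv ℝ Φ.toMap p v).1 := by
    intro p hp v
    have : HasFDerivAt Φ.T _ p := (hd p hp).fst
    rw [this.fderiv]; rfl
  have hdX : ∀ p ∈ Ω, ∀ v, fderiv ℝ Φ.X p v = (fderiv ℝ Φ.toMap p v).2.1 := by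
    intro p hp v
    have : HasFDerivAt Φ.X _ p := (hd p hp).snd.fst
    rw [this.fderiv]; rfl
  have hdU : ∀ p ∈ Ω, ∀ v, fderiv ℝ Φ.U p v = (fderiv ℝ Φ.toMap p v).2.2.1 := by
    intro p hp v
    have : HasFDerivAt Φ.U _ p := (hd p hp).snd.snd.fst
    rw [this.fderiv]; rfl
  let ℓt : ExtPt →L[ℝ] ℝ := ContinuousLinearMap.fst ℝ ℝ _
  let ℓx : ExtPt →L[ℝ] ℝ := (ContinuousLinearMap.fst ℝ ℝ _).comp (ContinuousLinearMap.snd ℝ ℝ _)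
  let ℓu : ExtPt →L[ℝ] ℝ := (ContinuousLinearMap.fst ℝ ℝ _).comp
    ((ContinuousLinearMap.snd ℝ ℝ _).comp (ContinuousLinearMap.snd ℝ ℝ _))
  -- `dX = a dx` and `dU = A du` on a connected set, with `a` and `A` locally constant in the `x`-
  -- and `u`-directions respectively, so both are constant. The factor of `dT` is then `a A ^ (-n)`,
  -- also constant.
  obtain ⟨δ₁, hδ₁⟩ := exists_fderiv_apply_eq_const (G := Φ.X) hΩ hc.isPreconnected hΦ.1.snd.fst ℓx
    (e := (0, 1, 0, 0, 0)) rfl (fun p hp v => by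
      obtain ⟨τ, a, A, -, -, hform, -⟩ := hg p hp
      rw [hdX p hp, hdX p hp, (hform v).2.1, (hform _).2.1]
      simp [ℓx]) (fun p hp => by
      obtain ⟨τ, a, A, -, -, hform, -, -, -, -, -, hsl, -⟩ := hg p hp
      filter_upwards [hsl, eventually_add_smul_mem hΩ hp (0, 1, 0, 0, 0)] with r hr hm
      rw [hdX _ hm, hdX p hp, hr, (hform _).2.1, mul_one])
  obtain ⟨δ₃, hδ₃⟩ := exists_fderiv_apply_eq_const (G := Φ.U) hΩ hc.isPreconnected
    hΦ.1.snd.snd.fst ℓu (e := (0, 0, 1, 0, 0)) rfl (fun p hp v => by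
      obtain ⟨τ, a, A, -, -, hform, -⟩ := hg p hp
      rw [hdU p hp, hdU p hp, (hform v).2.2, (hform _).2.2]
      simp [ℓu]) (fun p hp => by
      obtain ⟨τ, a, A, -, -, hform, -, -, -, -, -, -, hsl⟩ := hg p hp
      filter_upwards [hsl, eventually_add_smul_mem hΩ hp (0, 0, 1, 0, 0)] with r hr hm
      rw [hdU _ hm, hdU p hp, hr, (hform _).2.2, mul_one])
  have hall : ∀ p ∈ Ω, δ₁ ≠ 0 ∧ δ₃ ≠ 0 ∧
      (∀ v, (fderiv ℝ Φ.toMap p v).1 = δ₁ * δ₃ ^ (-n) * v.1 ∧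
        (fderiv ℝ Φ.toMap p v).2.1 = δ₁ * v.2.1) ∧
      Φ.U p = δ₃ * p.2.2.1 ∧ Φ.B p = δ₁ ^ 2 * δ₃ ^ n * p.2.2.2.1 ∧
      Φ.S p = δ₁ ^ 4 * δ₃ ^ n * p.2.2.2.2 ∧ Φ.N p = n := by
    intro p hp
    obtain ⟨τ, a, A, ha, hA, hform, hU, hτ, hB, hS, hN, -, -⟩ := hg p hp
    have e1 : a = δ₁ := by
      rw [← hδ₁ p hp, hdX p hp, (hform _).2.1, mul_one]
    have e3 : A = δ₃ := by
      rw [← hδ₃ p hp, hdU p hp, (hform _).2.2, mul_one]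
    subst e1 e3
    have hAn : A ^ n ≠ 0 := zpow_ne_zero _ hA
    have hτ' : τ = a * A ^ (-n) := by
      rw [zpow_neg]; field_simp; exact hτ
    have hτ0 : τ ≠ 0 := by
      rintro rfl
      rw [zero_mul] at hτ
      exact ha hτ.symm
    refine ⟨ha, hA, fun v => ⟨by rw [← hτ']; exact (hform v).1, (hform v).2.1⟩, hU, ?_, ?_, hN⟩
    · refine mul_right_cancel₀ hτ0 (hB.trans ?_)
      linear_combination (-p.2.2.2.1 * a ^ 2) * hτ
    · refine mul_right_cancel₀ hτ0 (hS.trans ?_)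
      linear_combination (-p.2.2.2.2 * a ^ 4) * hτ
  obtain ⟨δ₀, hδ₀⟩ := exists_eq_mul_add_const_of_fderiv (G := Φ.T) hΩ hc.isPreconnected
    (fun p hp => (hd p hp).fst.differentiableAt) ℓt (δ := δ₁ * δ₃ ^ (-n))
    (fun p hp v => by rw [hdT p hp, ((hall p hp).2.2.1 v).1]; rfl)
  obtain ⟨δ₂, hδ₂⟩ := exists_eq_mul_add_const_of_fderiv (G := Φ.X) hΩ hc.isPreconnected
    (fun p hp => (hd p hp).snd.fst.differentiableAt) ℓx (δ := δ₁)
    (fun p hp v => by rw [hdX p hp, ((hall p hp).2.2.1 v).2]; rfl)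
  obtain ⟨p₀, hp₀⟩ := hc.nonempty
  refine ⟨δ₀, δ₁, δ₂, δ₃, mul_ne_zero (hall p₀ hp₀).1 (hall p₀ hp₀).2.1,
    fun t x u b s hp => ?_⟩
  obtain ⟨-, -, -, hU, hB, hS, hN⟩ := hall _ hp
  exact ⟨hδ₀ _ hp, hδ₂ _ hp, hU, hB, hS, hN⟩

end ArbitraryElements
-- Every scaling and translation of the given form is an equivalence transformation.
section ScalingsAndTranslations

variable {n : ℤ} {Ω Ω' : Set ExtPt} {Φ : Transf} {δ₀ δ₁ δ₂ δ₃ : ℝ}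

theorem iteratedDeriv_comp_affine (G : ℝ → ℝ) (a b : ℝ) (k : ℕ) :
    iteratedDeriv k (fun x => G (a * x + b)) = fun x => a ^ k * iteratedDeriv k G (a * x + b) := by
  induction k with
  | zero => simp
  | succ k ih =>
    ext x
    rw [iteratedDeriv_succ, ih, deriv_const_mul_field,
      deriv_comp_mul_left a (fun y => iteratedDeriv k G (y + b)) x, deriv_comp_add_const,
      ← iteratedDeriv_succ, smul_eq_mul]
    ring

/-- The weights of `t`, `β` and `σ` are those for which all four terms of the equation scale by a
common factor. -/
theorem lhs_comp_affine {β σ β' σ' : ℝ → ℝ} {f g : ℝ × ℝ → ℝ} {t x : ℝ} (hδ₁ : δ₁ ≠ 0)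
    (hδ₃ : δ₃ ≠ 0) (hβ : β' (δ₁ * δ₃ ^ (-n) * t + δ₀) = δ₁ ^ 2 * δ₃ ^ n * β t)
    (hσ : σ' (δ₁ * δ₃ ^ (-n) * t + δ₀) = δ₁ ^ 4 * δ₃ ^ n * σ t)
    (hfg : ∀ᶠ z in 𝓝 (t, x), g (δ₁ * δ₃ ^ (-n) * z.1 + δ₀, δ₁ * z.2 + δ₂) = δ₃ * f z) :
    lhs n β σ f t x = δ₃⁻¹ * δ₁ * δ₃ ^ (-n)
      * lhs n β' σ' g (δ₁ * δ₃ ^ (-n) * t + δ₀) (δ₁ * x + δ₂) := by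
  set c := δ₁ * δ₃ ^ (-n) with hc
  have hf : ∀ᶠ z in 𝓝 (t, x), f z = δ₃⁻¹ * g (c * z.1 + δ₀, δ₁ * z.2 + δ₂) := by
    filter_upwards [hfg] with z hz
    rw [hz]
    field_simp
  have ht : (fun τ => f (τ, x)) =ᶠ[𝓝 t] fun τ => δ₃⁻¹ * g (c * τ + δ₀, δ₁ * x + δ₂) :=
    (show ContinuousAt (fun τ : ℝ => (τ, x)) t by fun_prop).eventually hf
  have hx : (fun ξ => f (t, ξ)) =ᶠ[𝓝 x] fun ξ => δ₃⁻¹ * g (c * t + δ₀, δ₁ * ξ + δ₂) :=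
    (show ContinuousAt (fun ξ : ℝ => (t, ξ)) x by fun_prop).eventually hf
  have hk : ∀ k : ℕ, iteratedDeriv k (fun ξ => f (t, ξ)) x
      = δ₃⁻¹ * (δ₁ ^ k * iteratedDeriv k (fun ξ => g (c * t + δ₀, ξ)) (δ₁ * x + δ₂)) := by
    intro k
    rw [hx.iteratedDeriv_eq k, iteratedDeriv_const_mul_field,
      iteratedDeriv_comp_affine (fun ξ => g (c * t + δ₀, ξ))]
  have h1 : deriv (fun τ => f (τ, x)) t
      = δ₃⁻¹ * (c * deriv (fun τ => g (τ, δ₁ * x + δ₂)) (c * t + δ₀)) := by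
    rw [ht.deriv_eq, ← iteratedDeriv_one, iteratedDeriv_const_mul_field,
      iteratedDeriv_comp_affine (fun τ => g (τ, δ₁ * x + δ₂)), pow_one, iteratedDeriv_one]
  have hval := hf.self_of_nhds
  have hz : δ₃ ^ n ≠ 0 := zpow_ne_zero _ hδ₃
  have h2 := hk 1
  rw [iteratedDeriv_one, iteratedDeriv_one] at h2
  rw [lhs, lhs, h1, h2, hk 3, hk 5, hval, hβ, hσ, mul_zpow, inv_zpow]
  generalize deriv (fun τ => g (τ, δ₁ * x + δ₂)) (c * t + δ₀) = g₀
  generalize g (c * t + δ₀, δ₁ * x + δ₂) ^ n = v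
  generalize deriv (fun ξ => g (c * t + δ₀, ξ)) (δ₁ * x + δ₂) = g₁
  generalize iteratedDeriv 3 (fun ξ => g (c * t + δ₀, ξ)) (δ₁ * x + δ₂) = g₃
  generalize iteratedDeriv 5 (fun ξ => g (c * t + δ₀, ξ)) (δ₁ * x + δ₂) = g₅
  rw [hc, zpow_neg]
  field_simp

/-- The action of a scaling and translation on the variables. -/
noncomputable def scale (n : ℤ) (δ₀ δ₁ δ₂ δ₃ : ℝ) (q : VarPt) : VarPt :=
  (δ₁ * δ₃ ^ (-n) * q.1 + δ₀, δ₁ * q.2.1 + δ₂, δ₃ * q.2.2)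

theorem isInvertible_fderiv_scale (hδ₁ : δ₁ ≠ 0) (hδ₃ : δ₃ ≠ 0) (q : VarPt) :
    (fderiv ℝ (scale n δ₀ δ₁ δ₂ δ₃) q).IsInvertible := by
  have h1 : HasFDerivAt (fun r : VarPt => r.1) (ContinuousLinearMap.fst ℝ ℝ (ℝ × ℝ)) q :=
    hasFDerivAt_fst
  have h2 : HasFDerivAt (fun r : VarPt => r.2) (ContinuousLinearMap.snd ℝ ℝ (ℝ × ℝ)) q :=
    hasFDerivAt_snd
  have h : HasFDerivAt (scale n δ₀ δ₁ δ₂ δ₃) _ q :=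
    ((h1.const_mul (δ₁ * δ₃ ^ (-n))).add_const δ₀).prodMk
      (((h2.fst.const_mul δ₁).add_const δ₂).prodMk (h2.snd.const_mul δ₃))
  rw [h.fderiv]
  refine isInvertible_of_injective _ fun v hv => ?_
  have hc : δ₁ * δ₃ ^ (-n) ≠ 0 := mul_ne_zero hδ₁ (zpow_ne_zero _ hδ₃)
  have e1 : δ₁ * δ₃ ^ (-n) * v.1 = 0 := congrArg Prod.fst hv
  have e2 : δ₁ * v.2.1 = 0 := congrArg (fun r => r.2.1) hv
  have e3 : δ₃ * v.2.2 = 0 := congrArg (fun r => r.2.2) hv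
  exact Prod.ext ((mul_eq_zero.1 e1).resolve_left hc)
    (Prod.ext ((mul_eq_zero.1 e2).resolve_left hδ₁) ((mul_eq_zero.1 e3).resolve_left hδ₃))

/-- The action of a scaling and translation on the variables and the arbitrary elements. -/
noncomputable def extScale (n : ℤ) (δ₀ δ₁ δ₂ δ₃ : ℝ) (p : ExtPt) : ExtPt :=
  (δ₁ * δ₃ ^ (-n) * p.1 + δ₀, δ₁ * p.2.1 + δ₂, δ₃ * p.2.2.1, δ₁ ^ 2 * δ₃ ^ n * p.2.2.2.1,
    δ₁ ^ 4 * δ₃ ^ n * p.2.2.2.2)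

theorem isInvertible_fderiv_extScale (hδ₁ : δ₁ ≠ 0) (hδ₃ : δ₃ ≠ 0) (p : ExtPt) :
    (fderiv ℝ (extScale n δ₀ δ₁ δ₂ δ₃) p).IsInvertible := by
  have h1 : HasFDerivAt (fun r : ExtPt => r.1) (ContinuousLinearMap.fst ℝ ℝ _) p := hasFDerivAt_fst
  have h2 : HasFDerivAt (fun r : ExtPt => r.2) (ContinuousLinearMap.snd ℝ ℝ _) p := hasFDerivAt_snd
  have h : HasFDerivAt (extScale n δ₀ δ₁ δ₂ δ₃) _ p :=
    ((h1.const_mul (δ₁ * δ₃ ^ (-n))).add_const δ₀).prodMk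
      (((h2.fst.const_mul δ₁).add_const δ₂).prodMk ((h2.snd.fst.const_mul δ₃).prodMk
        ((h2.snd.snd.fst.const_mul (δ₁ ^ 2 * δ₃ ^ n)).prodMk
          (h2.snd.snd.snd.const_mul (δ₁ ^ 4 * δ₃ ^ n)))))
  rw [h.fderiv]
  refine isInvertible_of_injective _ fun v hv => ?_
  have hz : ∀ m : ℤ, δ₃ ^ m ≠ 0 := fun m => zpow_ne_zero _ hδ₃
  have e1 : δ₁ * δ₃ ^ (-n) * v.1 = 0 := congrArg Prod.fst hv
  have e2 : δ₁ * v.2.1 = 0 := congrArg (fun r => r.2.1) hv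
  have e3 : δ₃ * v.2.2.1 = 0 := congrArg (fun r => r.2.2.1) hv
  have e4 : δ₁ ^ 2 * δ₃ ^ n * v.2.2.2.1 = 0 := congrArg (fun r => r.2.2.2.1) hv
  have e5 : δ₁ ^ 4 * δ₃ ^ n * v.2.2.2.2 = 0 := congrArg (fun r => r.2.2.2.2) hv
  exact Prod.ext ((mul_eq_zero.1 e1).resolve_left (mul_ne_zero hδ₁ (hz _)))
    (Prod.ext ((mul_eq_zero.1 e2).resolve_left hδ₁)
    (Prod.ext ((mul_eq_zero.1 e3).resolve_left hδ₃)
    (Prod.ext ((mul_eq_zero.1 e4).resolve_left (mul_ne_zero (pow_ne_zero _ hδ₁) (hz _)))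
      ((mul_eq_zero.1 e5).resolve_left (mul_ne_zero (pow_ne_zero _ hδ₁) (hz _))))))

theorem HasForm.toMap_eq (h : HasForm n δ₀ δ₁ δ₂ δ₃ Ω Φ) :
    Set.EqOn Φ.toMap (extScale n δ₀ δ₁ δ₂ δ₃) Ω := by
  rintro ⟨t, x, u, b, s⟩ hp
  obtain ⟨h1, h2, h3, h4, h5, -⟩ := h t x u b s hp
  simp only [Transf.toMap, extScale, h1, h2, h3, h4, h5]

theorem InClass.transform {J : Set ℝ} {β σ : ℝ → ℝ} (h : InClass n J β σ) {c d k l : ℝ}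
    (hk : k ≠ 0) (hl : l ≠ 0) :
    InClass n {s | (s - d) / c ∈ J} (fun s => k * β ((s - d) / c))
      (fun s => l * σ ((s - d) / c)) where
  exponent_ne_zero := h.exponent_ne_zero
  isOpen := h.isOpen.preimage (by fun_prop)
  ordConnected := by
    refine Convex.ordConnected fun x hx y hy a b ha hb hab => ?_
    have := h.ordConnected.convex hx hy ha hb hab
    have he : (a • x + b • y - d) / c = a • ((x - d) / c) + b • ((y - d) / c) := by
      simp only [smul_eq_mul]
      rw [← mul_div_assoc, ← mul_div_assoc, ← add_div]
      congr 1
      linear_combination d * hab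
    rw [Set.mem_ofPred_eq, he]
    exact this
  smooth_beta := contDiffOn_const.mul (h.smooth_beta.comp
    (f := fun s => (s - d) / c) (by fun_prop) fun s hs => hs)
  smooth_sigma := contDiffOn_const.mul (h.smooth_sigma.comp
    (f := fun s => (s - d) / c) (by fun_prop) fun s hs => hs)
  beta_ne_zero := fun s hs => mul_ne_zero hk (h.beta_ne_zero _ hs)
  sigma_ne_zero := fun s hs => mul_ne_zero hl (h.sigma_ne_zero _ hs)

theorem HasForm.isGeneralizedEquiv (hΩ : IsOpen Ω) (hv : Ω ⊆ validPts n) (hδ : δ₁ * δ₃ ≠ 0)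
    (h : HasForm n δ₀ δ₁ δ₂ δ₃ Ω Φ) : IsGeneralizedEquiv n Ω Φ := by
  have hδ₁ := left_ne_zero_of_mul hδ
  have hδ₃ := right_ne_zero_of_mul hδ
  have hc : δ₁ * δ₃ ^ (-n) ≠ 0 := mul_ne_zero hδ₁ (zpow_ne_zero _ hδ₃)
  refine ⟨?_, fun p hp => ?_, fun J β σ hcl => ?_⟩
  · refine ContDiffOn.congr (f := extScale n δ₀ δ₁ δ₂ δ₃) ?_ h.toMap_eq
    unfold extScale
    fun_prop
  · rw [(h.toMap_eq.eventuallyEq_of_mem (hΩ.mem_nhds hp)).fderiv_eq]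
    exact isInvertible_fderiv_extScale hδ₁ hδ₃ p
  -- The new coefficients are the old ones, rescaled and read at the old time `(t̃ - δ₀) / (δ₁ δ₃ ^
  -- (-n))`.
  · refine ⟨n, _, _, _, hcl.transform (c := δ₁ * δ₃ ^ (-n)) (d := δ₀) (k := δ₁ ^ 2 * δ₃ ^ n)
      (l := δ₁ ^ 4 * δ₃ ^ n) (mul_ne_zero (pow_ne_zero _ hδ₁) (zpow_ne_zero _ hδ₃))
      (mul_ne_zero (pow_ne_zero _ hδ₁) (zpow_ne_zero _ hδ₃)), fun q hq hqΩ => ?_⟩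
    have hform : ∀ r, lift β σ r ∈ Ω → Φ.induced β σ r = scale n δ₀ δ₁ δ₂ δ₃ r := by
      intro r hr
      obtain ⟨h1, h2, h3, -⟩ := h _ _ _ _ _ hr
      exact Prod.ext h1 (Prod.ext h2 h3)
    have hlift : ContinuousAt (lift β σ) q := by
      have hβ : ContinuousAt β q.1 := hcl.smooth_beta.continuousOn.continuousAt
        (hcl.isOpen.mem_nhds hq)
      have hσ : ContinuousAt σ q.1 := hcl.smooth_sigma.continuousOn.continuousAt
        (hcl.isOpen.mem_nhds hq)
      have h1 : ContinuousAt (fun r : VarPt => r.1) q := continuousAt_fst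
      exact h1.prodMk (continuousAt_snd.fst.prodMk (continuousAt_snd.snd.prodMk
        ((ContinuousAt.comp (g := β) hβ h1).prodMk (ContinuousAt.comp (g := σ) hσ h1))))
    have hev : Φ.induced β σ =ᶠ[𝓝 q] scale n δ₀ δ₁ δ₂ δ₃ := by
      filter_upwards [hlift.eventually_mem (hΩ.mem_nhds hqΩ)] with r hr using hform r hr
    obtain ⟨hT, hX, hU, hB, hS, hN⟩ := h _ _ _ _ _ hqΩ
    have hback : (δ₁ * δ₃ ^ (-n) * q.1 + δ₀ - δ₀) / (δ₁ * δ₃ ^ (-n)) = q.1 := by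
      rw [add_sub_cancel_right, mul_div_cancel_left₀ _ hc]
    refine ⟨?_, ?_, fun hneg => ?_, hN, ?_, ?_, ?_⟩
    · rw [hev.fderiv_eq]
      exact isInvertible_fderiv_scale hδ₁ hδ₃ q
    · change (Φ.T (lift β σ q) - δ₀) / _ ∈ J
      rw [show Φ.T (lift β σ q) = _ from hT, hback]
      exact hq
    · rw [show Φ.U (lift β σ q) = _ from hU]
      exact mul_ne_zero hδ₃ ((hv hqΩ).2.2 hneg)
    · rw [show Φ.T (lift β σ q) = _ from hT, hback]
      exact hB
    · rw [show Φ.T (lift β σ q) = _ from hT, hback]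
      exact hS
    · intro f g hf hfq _ _ hg
      have hgraph : Tendsto (fun z : ℝ × ℝ => ((z.1, z.2, f z) : VarPt)) (𝓝 (q.1, q.2.1)) (𝓝 q) := by
        have := (hasFDerivAt_graph hf).continuousAt.tendsto
        simpa [hfq] using this
      have hfg : ∀ᶠ z in 𝓝 (q.1, q.2.1),
          g (δ₁ * δ₃ ^ (-n) * z.1 + δ₀, δ₁ * z.2 + δ₂) = δ₃ * f z := by
        filter_upwards [hg, hgraph.eventually hev] with z h1 h2
        rw [h2] at h1
        exact h1
      have hl := lhs_comp_affine (n := n) (β := β) (σ := σ)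
        (β' := fun s => δ₁ ^ 2 * δ₃ ^ n * β ((s - δ₀) / (δ₁ * δ₃ ^ (-n))))
        (σ' := fun s => δ₁ ^ 4 * δ₃ ^ n * σ ((s - δ₀) / (δ₁ * δ₃ ^ (-n))))
        hδ₁ hδ₃ (by simp only [hback]) (by simp only [hback]) hfg
      rw [hl, hform q hqΩ]
      simp only [scale]
      have hne : δ₃⁻¹ * δ₁ * δ₃ ^ (-n) ≠ 0 :=
        mul_ne_zero (mul_ne_zero (inv_ne_zero hδ₃) hδ₁) (zpow_ne_zero _ hδ₃)
      simp only [mul_eq_zero, hne, false_or]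

theorem IsGeneralizedEquiv.mono (h : IsGeneralizedEquiv n Ω Φ) (hsub : Ω' ⊆ Ω) :
    IsGeneralizedEquiv n Ω' Φ := by
  refine ⟨h.1.mono hsub, fun p hp => h.2.1 p (hsub hp), fun J β σ hcl => ?_⟩
  obtain ⟨n', J', β', σ', hcl', hq⟩ := h.2.2 J β σ hcl
  exact ⟨n', J', β', σ', hcl', fun q hqJ hqΩ => hq q hqJ (hsub hqΩ)⟩

end ScalingsAndTranslations

/-! ### Usual equivalences: gluing over the signs of `β` and `σ`. -/

section UsualEquivalence

variable {n : ℤ} {D : Set VarPt} {Φ : Transf}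

theorem isOpen_overDomain (hD : IsOpen D) : IsOpen (overDomain D) := by
  have h1 : IsOpen {p : ExtPt | (p.1, p.2.1, p.2.2.1) ∈ D} := hD.preimage (by fun_prop)
  have h2 : IsOpen {p : ExtPt | p.2.2.2.1 ≠ 0} := isOpen_ne.preimage (by fun_prop)
  have h3 : IsOpen {p : ExtPt | p.2.2.2.2 ≠ 0} := isOpen_ne.preimage (by fun_prop)
  exact h1.inter (h2.inter h3)

theorem overDomain_subset_validPts (hD : n < 0 → ∀ q ∈ D, q.2.2 ≠ 0) :
    overDomain D ⊆ validPts n := fun _ hp => ⟨hp.2.1, hp.2.2, fun hn => hD hn _ hp.1⟩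

/-- The part of `overDomain D` on which `β` and `σ` have the signs of `ε` and `ε'`. -/
def overDomainSign (D : Set VarPt) (ε ε' : ℝ) : Set ExtPt :=
  {p | (p.1, p.2.1, p.2.2.1) ∈ D ∧ 0 < ε * p.2.2.2.1 ∧ 0 < ε' * p.2.2.2.2}

theorem overDomainSign_subset (ε ε' : ℝ) : overDomainSign D ε ε' ⊆ overDomain D :=
  fun _ hp => ⟨hp.1, right_ne_zero_of_mul hp.2.1.ne', right_ne_zero_of_mul hp.2.2.ne'⟩

theorem isOpen_overDomainSign (hD : IsOpen D) (ε ε' : ℝ) : IsOpen (overDomainSign D ε ε') := by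
  have h1 : IsOpen {p : ExtPt | (p.1, p.2.1, p.2.2.1) ∈ D} := hD.preimage (by fun_prop)
  have h2 : IsOpen {p : ExtPt | 0 < ε * p.2.2.2.1} := isOpen_lt (by fun_prop) (by fun_prop)
  have h3 : IsOpen {p : ExtPt | 0 < ε' * p.2.2.2.2} := isOpen_lt (by fun_prop) (by fun_prop)
  exact h1.inter (h2.inter h3)

theorem isConnected_setOf_pos_mul {ε : ℝ} (hε : ε ≠ 0) : IsConnected {b : ℝ | 0 < ε * b} := by
  refine ⟨⟨ε, mul_self_pos.2 hε⟩, Convex.isPreconnected fun x hx y hy a b ha hb hab => ?_⟩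
  have hx' : 0 < ε * x := hx
  have hy' : 0 < ε * y := hy
  change 0 < ε * (a * x + b * y)
  rcases ha.eq_or_lt with rfl | ha'
  · have : b = 1 := by linarith
    subst this
    simpa using hy'
  · have h1 := mul_pos ha' hx'
    have h2 := mul_nonneg hb hy'.le
    linarith

theorem isConnected_overDomainSign (hD : IsConnected D) {ε ε' : ℝ} (hε : ε ≠ 0) (hε' : ε' ≠ 0) :
    IsConnected (overDomainSign D ε ε') := by
  have h := (hD.prod ((isConnected_setOf_pos_mul hε).prod (isConnected_setOf_pos_mul hε'))).image
    (fun r : VarPt × ℝ × ℝ => ((r.1.1, r.1.2.1, r.1.2.2, r.2.1, r.2.2) : ExtPt))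
    (by fun_prop : Continuous _).continuousOn
  convert h using 1
  ext p
  constructor
  · intro hp
    exact ⟨((p.1, p.2.1, p.2.2.1), p.2.2.2.1, p.2.2.2.2), ⟨hp.1, hp.2.1, hp.2.2⟩, rfl⟩
  · rintro ⟨r, ⟨h1, h2, h3⟩, rfl⟩
    exact ⟨h1, h2, h3⟩

/-- Subtracting the relations at two points that differ in all three coordinates gives the slopes,
and then the translations. -/
theorem scale_constants_unique {c c' δ₀ δ₁ δ₂ δ₃ δ₀' δ₁' δ₂' δ₃' : ℝ} (hD : IsOpen D)
    (hne : D.Nonempty)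
    (h : ∀ q ∈ D, c * q.1 + δ₀ = c' * q.1 + δ₀' ∧ δ₁ * q.2.1 + δ₂ = δ₁' * q.2.1 + δ₂' ∧
      δ₃ * q.2.2 = δ₃' * q.2.2) : δ₀ = δ₀' ∧ δ₁ = δ₁' ∧ δ₂ = δ₂' ∧ δ₃ = δ₃' := by
  obtain ⟨q, hq⟩ := hne
  obtain ⟨s, hs, hs0⟩ := (((eventually_add_smul_mem hD hq (1, 1, 1)).filter_mono
    nhdsWithin_le_nhds).and (eventually_nhdsNE_ne 0 0)).exists
  obtain ⟨a1, a2, a3⟩ := h q hq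
  obtain ⟨b1, b2, b3⟩ := h _ hs
  simp only [Prod.fst_add, Prod.snd_add, Prod.smul_fst, Prod.smul_snd, smul_eq_mul,
    mul_one] at b1 b2 b3
  have ec : c = c' := mul_left_cancel₀ hs0 (by linarith)
  have e1 : δ₁ = δ₁' := mul_left_cancel₀ hs0 (by linarith)
  have e3 : δ₃ = δ₃' := mul_left_cancel₀ hs0 (by linarith)
  subst ec e1 e3
  exact ⟨by linarith, rfl, by linarith, rfl⟩

theorem HasForm.isUsualEquiv {δ₀ δ₁ δ₂ δ₃ : ℝ} (hD : IsOpen D)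
    (hv : n < 0 → ∀ q ∈ D, q.2.2 ≠ 0) (hδ : δ₁ * δ₃ ≠ 0)
    (h : HasForm n δ₀ δ₁ δ₂ δ₃ (overDomain D) Φ) : IsUsualEquiv n D Φ := by
  refine ⟨h.isGeneralizedEquiv (isOpen_overDomain hD) (overDomain_subset_validPts hv) hδ,
    scale n δ₀ δ₁ δ₂ δ₃, fun p hp => ?_⟩
  obtain ⟨h1, h2, h3, -⟩ := h _ _ _ _ _ hp
  exact Prod.ext h1 (Prod.ext h2 h3)

/-- `overDomain D` is not connected, so the generalized result applies only to each sign pattern of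
`(β, σ)` separately. The map `F` of `(t, x, u)` is common to all of them and determines the
constants, which therefore coincide. -/
theorem IsUsualEquiv.exists_hasForm (hn : n ≠ 0) (hn1 : n ≠ 1) (hD : IsOpen D)
    (hc : IsConnected D) (hv : n < 0 → ∀ q ∈ D, q.2.2 ≠ 0) (hΦ : IsUsualEquiv n D Φ) :
    ∃ δ₀ δ₁ δ₂ δ₃ : ℝ, δ₁ * δ₃ ≠ 0 ∧ HasForm n δ₀ δ₁ δ₂ δ₃ (overDomain D) Φ := by
  obtain ⟨hg, F, hF⟩ := hΦ
  have hsign : ∀ ε ε' : ℝ, ε ≠ 0 → ε' ≠ 0 → ∃ δ₀ δ₁ δ₂ δ₃ : ℝ, δ₁ * δ₃ ≠ 0 ∧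
      HasForm n δ₀ δ₁ δ₂ δ₃ (overDomainSign D ε ε') Φ := fun ε ε' hε hε' =>
    (hg.mono (overDomainSign_subset ε ε')).exists_hasForm hn hn1 (isOpen_overDomainSign hD ε ε')
      (isConnected_overDomainSign hc hε hε')
      ((overDomainSign_subset ε ε').trans (overDomain_subset_validPts hv))
  have hval : ∀ {ε ε' δ₀ δ₁ δ₂ δ₃ : ℝ}, ε ≠ 0 → ε' ≠ 0 →
      HasForm n δ₀ δ₁ δ₂ δ₃ (overDomainSign D ε ε') Φ →
      ∀ q ∈ D, F q = scale n δ₀ δ₁ δ₂ δ₃ q := by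
    intro ε ε' δ₀ δ₁ δ₂ δ₃ hε hε' h q hq
    have hp : (q.1, q.2.1, q.2.2, ε, ε') ∈ overDomainSign D ε ε' :=
      ⟨hq, mul_self_pos.2 hε, mul_self_pos.2 hε'⟩
    obtain ⟨h1, h2, h3, -⟩ := h _ _ _ _ _ hp
    rw [← hF _ (overDomainSign_subset ε ε' hp)]
    exact Prod.ext h1 (Prod.ext h2 h3)
  obtain ⟨δ₀, δ₁, δ₂, δ₃, hδ, hform⟩ := hsign 1 1 one_ne_zero one_ne_zero
  refine ⟨δ₀, δ₁, δ₂, δ₃, hδ, fun t x u b s hp => ?_⟩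
  obtain ⟨hq, hb, hs⟩ := hp
  -- Taking `b`, `s` themselves as sign representatives puts the given point in the corresponding
  -- component.
  obtain ⟨δ₀', δ₁', δ₂', δ₃', -, hform'⟩ := hsign b s hb hs
  obtain ⟨rfl, rfl, rfl, rfl⟩ := scale_constants_unique (c := δ₁' * δ₃' ^ (-n))
    (c' := δ₁ * δ₃ ^ (-n)) hD hc.nonempty fun q hq => by
      have he := (hval hb hs hform' q hq).symm.trans (hval one_ne_zero one_ne_zero hform q hq)
      exact ⟨congrArg Prod.fst he, congrArg (fun r => r.2.1) he, congrArg (fun r => r.2.2) he⟩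
  exact hform' t x u b s ⟨hq, mul_self_pos.2 hb, mul_self_pos.2 hs⟩

end UsualEquivalence
end Kawahara

theorem corollary1 (n : ℤ) (hn : n ≠ 0) :
    (∀ (Ω : Set Kawahara.ExtPt) (Φ : Kawahara.Transf) (δ₀ δ₁ δ₂ δ₃ : ℝ),
      IsOpen Ω → Ω ⊆ Kawahara.validPts n → δ₁ * δ₃ ≠ 0 →
      Kawahara.HasForm n δ₀ δ₁ δ₂ δ₃ Ω Φ → Kawahara.IsGeneralizedEquiv n Ω Φ) ∧
    (n ≠ 1 →
      (∀ (Ω : Set Kawahara.ExtPt) (Φ : Kawahara.Transf),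
        IsOpen Ω → IsConnected Ω → Ω ⊆ Kawahara.validPts n →
        (Kawahara.IsGeneralizedEquiv n Ω Φ ↔
          ∃ δ₀ δ₁ δ₂ δ₃ : ℝ, δ₁ * δ₃ ≠ 0 ∧ Kawahara.HasForm n δ₀ δ₁ δ₂ δ₃ Ω Φ)) ∧
      (∀ (D : Set Kawahara.VarPt) (Φ : Kawahara.Transf),
        IsOpen D → IsConnected D → (n < 0 → ∀ q ∈ D, q.2.2 ≠ 0) →
        (Kawahara.IsUsualEquiv n D Φ ↔
          ∃ δ₀ δ₁ δ₂ δ₃ : ℝ, δ₁ * δ₃ ≠ 0 ∧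
            Kawahara.HasForm n δ₀ δ₁ δ₂ δ₃ (Kawahara.overDomain D) Φ))) := by
  refine ⟨fun Ω Φ δ₀ δ₁ δ₂ δ₃ hΩ hv hδ h => h.isGeneralizedEquiv hΩ hv hδ, fun hn1 =>
    ⟨fun Ω Φ hΩ hc hv => ⟨fun h => h.exists_hasForm hn hn1 hΩ hc hv, ?_⟩,
      fun D Φ hD hc hv => ⟨fun h => h.exists_hasForm hn hn1 hD hc hv, ?_⟩⟩⟩
  · rintro ⟨δ₀, δ₁, δ₂, δ₃, hδ, h⟩
    exact h.isGeneralizedEquiv hΩ hv hδ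
  · rintro ⟨δ₀, δ₁, δ₂, δ₃, hδ, h⟩
    exact h.isUsualEquiv hD hv hδ
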